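/- **Setting.** Let $\mathcal O\subseteq\mathbb R^3$ be bounded and open, let $m\ge 3$ and $k=m-2$. Let $L$ be a linear differential operator of finite order with $3\times 3$ matrix coefficients that maps $[\mathbb C_0^\infty(\mathcal O)]^3$ (smooth vector fields with compact support in $\mathcal O$) into $L^2(\mathcal O;\mathbb R^3)$, and put $\|f\|_L^2=\sum_{i=1}^3\int_{\mathcal O}|(Lf)_i(u)|^2\,du$. Assume that there is a constant $c\in(0,\infty)$ such that $$\|f\|_L\ \ge\ c\,\Big(\sum_{i=1}^3\int_{\mathcal O}\sum_{|\alpha|\le m+2}|\partial^\alpha f_i(u)|^2\,du\Big)^{1/2}\qquad\text{for all } f\in[\mathbb C_0^\infty(\mathcal O)]^3 .$$ Let $H$ be the Hilbert space completion of $[\mathbb C_0^\infty(\mathcal O)]^3$ under $\|\cdot\|_L$; its elements are evaluated at points of $\mathbb R^3$ by continuous extension of $f\mapsto f(x)$ (the $f\in[\mathbb C_0^\infty(\mathcal O)]^3$ being extended by $0$). Let $\mathcal H=L^2([0,1]:H)$. For $\vartheta\in\mathcal H$ let $h_\vartheta(x)=\eta_{0,1}(x)$ for $x\in\mathcal O$,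 where $\eta_{0,t}(x)=x+\int_0^t\vartheta(\eta_{0,r}(x),r)\,dr$, $t\in[0,1]$, and $h_\vartheta(x)=x$ for $x\notin\mathcal O$. For an integer $n\ge 0$ let $G^n$ be the group of $\mathbb C^n$-diffeomorphisms of $\mathbb R^3$ (homeomorphisms if $n=0$) with the metric $d_n(\phi,\psi)=\lambda_n(\phi,\psi)+\lambda_n(\phi^{-1},\psi^{-1})$, where $$\lambda_n(\phi,\psi)=\sum_{|\alpha|\le n}\rho(\partial^\alpha\phi,\partial^\alpha\psi),\qquad \rho(\phi,\psi)=\sum_{N=1}^\infty 2^{-N}\,\frac{\sup_{|x|\le N}|\phi(x)-\psi(x)|}{1+\sup_{|x|\le N}|\phi(x)-\psi(x)|}.$$ Let $T:\mathcal O\to\mathbb R^p$ be continuous and bounded, let $\{\mathbb X_i\}_{i\in\mathcal L}$ be a finite family of disjoint measurable sets with union $\mathcal O$, let $d=(d_i)_{i\in\mathcal L}$ with $d_i\in\mathbb R^p$, and put $Y_d(x)=d_i$ for $x\in\mathbb X_i$. Define $$J_d(\vartheta)=\tfrac12\Big(\|\vartheta\|_{\mathcal H}^2+\int_{\mathcal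 O}|T(h_\vartheta(x))-Y_d(x)|^2\,dx\Big)\quad(\vartheta\in\mathcal H),\qquad \hat J_d(h)=\inf\{J_d(\vartheta):\vartheta\in\mathcal H,\ h_\vartheta=h\}\quad(\inf\emptyset=\infty),$$ $$\lambda_d=\inf_{h\in G^{k-1}}\hat J_d(h),\qquad I_d(h)=\hat J_d(h)-\lambda_d\quad(h\in G^{k-1}).$$ **Proposition 5.3.** For every $d$, one has $\lambda_d=\inf_{\vartheta\in\mathcal H}J_d(\vartheta)<\infty$, and $I_d:G^{k-1}\to[0,\infty]$ is a rate function on $G^{k-1}$, that is, for each $M<\infty$ the level set $\{h\in G^{k-1}: I_d(h)\le M\}$ is a compact subset of $G^{k-1}$. -/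

import Mathlib

open MeasureTheory Set TopologicalSpace
open scoped ENNReal NNReal Distributions Manifold ContDiff

namespace ImageMatching

noncomputable section

/-- The space `ℝ³` with the Euclidean norm. -/
abbrev E3 : Type := EuclideanSpace ℝ (Fin 3)

/-! ### Partial derivatives -/

/-- The partial derivative `∂f/∂xᵢ`. -/
def partialD (i : Fin 3) (f : E3 → E3) : E3 → E3 :=
  fun x => fderiv ℝ f x (EuclideanSpace.single i (1 : ℝ))

/-- The partial derivative `∂^α f = ∂^{|α|} f / (∂x₁^{α₁} ∂x₂^{α₂} ∂x₃^{α₃})`. -/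
def multiD (α : Fin 3 → ℕ) (f : E3 → E3) : E3 → E3 :=
  (partialD 0)^[α 0] ((partialD 1)^[α 1] ((partialD 2)^[α 2] f))

/-- The multi-indices `α ∈ ℕ³` with `|α| = α₁ + α₂ + α₃ ≤ n`. -/
def multiIdx (n : ℕ) : Finset (Fin 3 → ℕ) :=
  (Fintype.piFinset fun _ => Finset.range (n + 1)).filter fun α => ∑ i, α i ≤ n

theorem mem_multiIdx {n : ℕ} {α : Fin 3 → ℕ} : α ∈ multiIdx n ↔ ∑ i, α i ≤ n := by
  simp only [multiIdx, Finset.mem_filter, Fintype.mem_piFinset, Finset.mem_range,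
    and_iff_right_iff_imp]
  intro h i
  have := Finset.single_le_sum (f := α) (fun j _ => Nat.zero_le _) (Finset.mem_univ i)
  omega

theorem contDiff_partialD {n : ℕ} {f : E3 → E3} (hf : ContDiff ℝ ((n + 1 : ℕ) : ℕ∞ω) f)
    (i : Fin 3) : ContDiff ℝ ((n : ℕ) : ℕ∞ω) (partialD i f) := by
  unfold partialD
  exact (hf.fderiv_right (by exact_mod_cast le_refl _)).clm_apply contDiff_const

theorem contDiff_iterate_partialD {n a : ℕ} {f : E3 → E3}
    (hf : ContDiff ℝ ((n + a : ℕ) : ℕ∞ω) f) (i : Fin 3) :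
    ContDiff ℝ ((n : ℕ) : ℕ∞ω) ((partialD i)^[a] f) := by
  induction a generalizing f with
  | zero => simpa using hf
  | succ a ih =>
    rw [Function.iterate_succ_apply]
    exact ih (contDiff_partialD hf i)

theorem contDiff_multiD {n : ℕ} {α : Fin 3 → ℕ} {f : E3 → E3}
    (hf : ContDiff ℝ ((n + ∑ i, α i : ℕ) : ℕ∞ω) f) :
    ContDiff ℝ ((n : ℕ) : ℕ∞ω) (multiD α f) := by
  unfold multiD
  refine contDiff_iterate_partialD (contDiff_iterate_partialD
    (contDiff_iterate_partialD ?_ 2) 1) 0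
  rw [Fin.sum_univ_three] at hf
  convert hf using 2
  ring

theorem continuous_multiD {m : ℕ} {α : Fin 3 → ℕ} {f : E3 → E3}
    (hf : ContDiff ℝ ((m : ℕ) : ℕ∞ω) f) (hα : α ∈ multiIdx m) :
    Continuous (multiD α f) := by
  refine (contDiff_multiD (n := 0) (hf.of_le ?_)).continuous
  have := mem_multiIdx.1 hα
  exact_mod_cast (by omega : 0 + ∑ i, α i ≤ m)

theorem partialD_add {f g : E3 → E3} (hf : Differentiable ℝ f) (hg : Differentiable ℝ g)
    (i : Fin 3) : partialD i (f + g) = partialD i f + partialD i g := by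
  funext x
  simp [partialD, fderiv_add (hf x) (hg x)]

theorem partialD_smul {f : E3 → E3} (hf : Differentiable ℝ f) (c : ℝ)
    (i : Fin 3) : partialD i (c • f) = c • partialD i f := by
  funext x
  simp [partialD, fderiv_const_smul (hf x) c]

theorem contDiff_partialD_infty {f : E3 → E3} (hf : ContDiff ℝ ∞ f) (i : Fin 3) :
    ContDiff ℝ ∞ (partialD i f) := by
  unfold partialD
  exact (hf.fderiv_right (by simp)).clm_apply contDiff_const

theorem contDiff_iterate_partialD_infty {f : E3 → E3} (hf : ContDiff ℝ ∞ f) (i : Fin 3) (a : ℕ) :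
    ContDiff ℝ ∞ ((partialD i)^[a] f) := by
  induction a generalizing f with
  | zero => simpa using hf
  | succ a ih =>
    rw [Function.iterate_succ_apply]
    exact ih (contDiff_partialD_infty hf i)

theorem iterate_partialD_add {f g : E3 → E3} (hf : ContDiff ℝ ∞ f) (hg : ContDiff ℝ ∞ g)
    (i : Fin 3) (a : ℕ) :
    (partialD i)^[a] (f + g) = (partialD i)^[a] f + (partialD i)^[a] g := by
  induction a generalizing f g with
  | zero => rfl
  | succ a ih =>
    simp only [Function.iterate_succ_apply]
    rw [partialD_add (hf.differentiable (by simp)) (hg.differentiable (by simp)),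
      ih (contDiff_partialD_infty hf i) (contDiff_partialD_infty hg i)]

theorem iterate_partialD_smul {f : E3 → E3} (hf : ContDiff ℝ ∞ f) (c : ℝ)
    (i : Fin 3) (a : ℕ) :
    (partialD i)^[a] (c • f) = c • (partialD i)^[a] f := by
  induction a generalizing f with
  | zero => rfl
  | succ a ih =>
    simp only [Function.iterate_succ_apply]
    rw [partialD_smul (hf.differentiable (by simp)), ih (contDiff_partialD_infty hf i)]

theorem multiD_add {f g : E3 → E3} (hf : ContDiff ℝ ∞ f) (hg : ContDiff ℝ ∞ g)
    (α : Fin 3 → ℕ) : multiD α (f + g) = multiD α f + multiD α g := by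
  unfold multiD
  have h2 := fun h (hh : ContDiff ℝ ∞ h) => contDiff_iterate_partialD_infty hh 2 (α 2)
  have h1 := fun h (hh : ContDiff ℝ ∞ h) => contDiff_iterate_partialD_infty hh 1 (α 1)
  rw [iterate_partialD_add hf hg, iterate_partialD_add (h2 _ hf) (h2 _ hg),
    iterate_partialD_add (h1 _ (h2 _ hf)) (h1 _ (h2 _ hg))]

theorem multiD_smul {f : E3 → E3} (hf : ContDiff ℝ ∞ f) (c : ℝ)
    (α : Fin 3 → ℕ) : multiD α (c • f) = c • multiD α f := by
  unfold multiD
  have h2 := fun h (hh : ContDiff ℝ ∞ h) => contDiff_iterate_partialD_infty hh 2 (α 2)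
  have h1 := fun h (hh : ContDiff ℝ ∞ h) => contDiff_iterate_partialD_infty hh 1 (α 1)
  rw [iterate_partialD_smul hf, iterate_partialD_smul (h2 _ hf),
    iterate_partialD_smul (h1 _ (h2 _ hf))]

/-! ### The group `G^m` of `C^m`-diffeomorphisms of `ℝ³` and its metric `d_m` -/

/-- `sup_{|x| ≤ N} |f(x) - g(x)|`. -/
def supBall (N : ℕ) (f g : E3 → E3) : ℝ :=
  ⨆ x : Metric.closedBall (0 : E3) (N : ℝ), ‖f x - g x‖

/-- `ρ(f, g) = ∑_{N ≥ 1} 2^{-N} s_N / (1 + s_N)` with `s_N = sup_{|x| ≤ N} |f(x) - g(x)|`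
(the summation index is shifted by one). -/
def rho (f g : E3 → E3) : ℝ :=
  ∑' N : ℕ, (1 / 2 : ℝ) ^ (N + 1) * (supBall (N + 1) f g / (1 + supBall (N + 1) f g))

/-- `λ_m(f, g) = ∑_{|α| ≤ m} ρ(∂^α f, ∂^α g)`. -/
def lamDist (m : ℕ) (f g : E3 → E3) : ℝ :=
  ∑ α ∈ multiIdx m, rho (multiD α f) (multiD α g)

theorem supBall_nonneg (N : ℕ) (f g : E3 → E3) : 0 ≤ supBall N f g :=
  Real.iSup_nonneg fun _ => norm_nonneg _

theorem le_supBall {N : ℕ} {f g : E3 → E3} (hf : Continuous f) (hg : Continuous g) {x : E3}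
    (hx : x ∈ Metric.closedBall (0 : E3) (N : ℝ)) : ‖f x - g x‖ ≤ supBall N f g := by
  refine le_ciSup (f := fun x : Metric.closedBall (0 : E3) (N : ℝ) => ‖f x - g x‖) ?_ ⟨x, hx⟩
  have := ((isCompact_closedBall (0 : E3) (N : ℝ)).image (hf.sub hg).norm).bddAbove
  refine this.mono ?_
  rintro _ ⟨y, rfl⟩
  exact ⟨y, y.2, rfl⟩

theorem supBall_self (N : ℕ) (f : E3 → E3) : supBall N f f = 0 := by
  simp [supBall]

theorem supBall_comm (N : ℕ) (f g : E3 → E3) : supBall N f g = supBall N g f := by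
  simp only [supBall, norm_sub_rev]

theorem supBall_triangle {N : ℕ} {f g h : E3 → E3} (hf : Continuous f) (hg : Continuous g)
    (hh : Continuous h) : supBall N f h ≤ supBall N f g + supBall N g h := by
  refine Real.iSup_le (fun x => ?_) (add_nonneg (supBall_nonneg _ _ _) (supBall_nonneg _ _ _))
  calc ‖f x - h x‖ = ‖(f x - g x) + (g x - h x)‖ := by congr 1; abel
    _ ≤ ‖f x - g x‖ + ‖g x - h x‖ := norm_add_le _ _
    _ ≤ _ := add_le_add (le_supBall hf hg x.2) (le_supBall hg hh x.2)

theorem rho_term_nonneg (N : ℕ) (f g : E3 → E3) :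
    0 ≤ (1 / 2 : ℝ) ^ (N + 1) * (supBall (N + 1) f g / (1 + supBall (N + 1) f g)) := by
  have := supBall_nonneg (N + 1) f g
  positivity

theorem summable_rho (f g : E3 → E3) :
    Summable fun N : ℕ =>
      (1 / 2 : ℝ) ^ (N + 1) * (supBall (N + 1) f g / (1 + supBall (N + 1) f g)) := by
  refine Summable.of_nonneg_of_le (fun N => rho_term_nonneg N f g) (fun N => ?_)
    ((summable_nat_add_iff 1).2 summable_geometric_two)
  have h := supBall_nonneg (N + 1) f g
  have h1 : supBall (N + 1) f g / (1 + supBall (N + 1) f g) ≤ 1 := by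
    rw [div_le_one (by positivity)]
    linarith
  exact mul_le_of_le_one_right (by positivity) h1

theorem rho_nonneg (f g : E3 → E3) : 0 ≤ rho f g :=
  tsum_nonneg fun N => rho_term_nonneg N f g

theorem rho_self (f : E3 → E3) : rho f f = 0 := by
  simp [rho, supBall_self]

theorem rho_comm (f g : E3 → E3) : rho f g = rho g f := by
  simp only [rho, supBall_comm]

theorem rho_triangle {f g h : E3 → E3} (hf : Continuous f) (hg : Continuous g)
    (hh : Continuous h) : rho f h ≤ rho f g + rho g h := by
  unfold rho
  rw [← (summable_rho f g).tsum_add (summable_rho g h)]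
  refine (summable_rho f h).tsum_le_tsum (fun N => ?_) ((summable_rho f g).add (summable_rho g h))
  rw [← mul_add]
  refine mul_le_mul_of_nonneg_left ?_ (by positivity)
  have h0 := supBall_nonneg (N + 1) f h
  have h1 := supBall_nonneg (N + 1) f g
  have h2 := supBall_nonneg (N + 1) g h
  have h3 := supBall_triangle (N := N + 1) hf hg hh
  set a := supBall (N + 1) f h
  set b := supBall (N + 1) f g
  set c := supBall (N + 1) g h
  calc a / (1 + a) ≤ (b + c) / (1 + (b + c)) := by
        rw [div_le_div_iff₀ (by positivity) (by positivity)]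
        nlinarith
    _ = b / (1 + (b + c)) + c / (1 + (b + c)) := add_div _ _ _
    _ ≤ b / (1 + b) + c / (1 + c) := by
        gcongr <;> linarith

theorem eq_of_rho_eq_zero {f g : E3 → E3} (hf : Continuous f) (hg : Continuous g)
    (h : rho f g = 0) : f = g := by
  funext x
  obtain ⟨N, hN⟩ := exists_nat_ge ‖x‖
  have hs := (summable_rho f g).hasSum
  change HasSum _ (rho f g) at hs
  rw [h] at hs
  have h0 := (hasSum_zero_iff_of_nonneg fun N => rho_term_nonneg N f g).1 hs
  have h1 := congrFun h0 N
  have h2 := supBall_nonneg (N + 1) f g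
  have h3 : supBall (N + 1) f g = 0 := by
    simp only [Pi.zero_apply, mul_eq_zero, div_eq_zero_iff] at h1
    rcases h1 with h1 | h1 | h1
    · exact absurd h1 (by positivity)
    · exact h1
    · linarith
  have h4 := le_supBall (N := N + 1) hf hg (x := x)
    (by simp only [mem_closedBall_zero_iff]; push_cast; linarith)
  rw [h3] at h4
  exact sub_eq_zero.1 (norm_le_zero_iff.1 h4)

/-- The set `G^m` of all `C^m`-diffeomorphisms of `ℝ³` onto itself
(homeomorphisms when `m = 0`). -/
def DiffeoGroup (m : ℕ) : Type :=
  Diffeomorph 𝓘(ℝ, E3) 𝓘(ℝ, E3) E3 E3 (m : ℕ∞ω)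

instance (m : ℕ) : CoeFun (DiffeoGroup m) (fun _ => E3 → E3) :=
  ⟨fun h => h.toEquiv⟩

/-- The inverse map `h⁻¹` of `h ∈ G^m`. -/
def DiffeoGroup.inv {m : ℕ} (h : DiffeoGroup m) : E3 → E3 := h.toEquiv.symm

theorem DiffeoGroup.contDiff {m : ℕ} (h : DiffeoGroup m) : ContDiff ℝ (m : ℕ∞ω) h :=
  h.contMDiff_toFun.contDiff

theorem DiffeoGroup.contDiff_inv {m : ℕ} (h : DiffeoGroup m) : ContDiff ℝ (m : ℕ∞ω) h.inv :=
  h.contMDiff_invFun.contDiff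

theorem DiffeoGroup.ext {m : ℕ} {g h : DiffeoGroup m} (H : (g : E3 → E3) = h) : g = h :=
  Diffeomorph.toEquiv_injective (DFunLike.ext' H)

theorem lamDist_triangle {m : ℕ} {f g h : E3 → E3} (hf : ContDiff ℝ (m : ℕ∞ω) f)
    (hg : ContDiff ℝ (m : ℕ∞ω) g) (hh : ContDiff ℝ (m : ℕ∞ω) h) :
    lamDist m f h ≤ lamDist m f g + lamDist m g h := by
  unfold lamDist
  rw [← Finset.sum_add_distrib]
  exact Finset.sum_le_sum fun α hα => rho_triangle (continuous_multiD hf hα)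
    (continuous_multiD hg hα) (continuous_multiD hh hα)

theorem lamDist_nonneg (m : ℕ) (f g : E3 → E3) : 0 ≤ lamDist m f g :=
  Finset.sum_nonneg fun _ _ => rho_nonneg _ _

theorem eq_of_lamDist_eq_zero {m : ℕ} {f g : E3 → E3} (hf : ContDiff ℝ (m : ℕ∞ω) f)
    (hg : ContDiff ℝ (m : ℕ∞ω) g) (h : lamDist m f g = 0) : f = g := by
  have h0 : (0 : Fin 3 → ℕ) ∈ multiIdx m := mem_multiIdx.2 (by simp)
  have := (Finset.sum_eq_zero_iff_of_nonneg fun α _ => rho_nonneg _ _).1 h 0 h0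
  exact eq_of_rho_eq_zero (f := f) (g := g) hf.continuous hg.continuous this

/-- `G^m` with the metric `d_m(φ, ψ) = λ_m(φ, ψ) + λ_m(φ⁻¹, ψ⁻¹)`. -/
instance (m : ℕ) : MetricSpace (DiffeoGroup m) where
  dist φ ψ := lamDist m φ ψ + lamDist m φ.inv ψ.inv
  dist_self φ := by simp [lamDist, rho_self]
  dist_comm φ ψ := by simp [lamDist, rho_comm]
  dist_triangle φ ψ χ := by
    have h1 := lamDist_triangle φ.contDiff ψ.contDiff χ.contDiff
    have h2 := lamDist_triangle φ.contDiff_inv ψ.contDiff_inv χ.contDiff_inv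
    linarith
  eq_of_dist_eq_zero {φ ψ} h := by
    have h1 := lamDist_nonneg m φ ψ
    have h2 := lamDist_nonneg m φ.inv ψ.inv
    exact DiffeoGroup.ext (eq_of_lamDist_eq_zero φ.contDiff ψ.contDiff
      (by change lamDist m φ ψ + lamDist m φ.inv ψ.inv = 0 at h; linarith))

/-- A rate function: a `[0, ∞]`-valued function whose sublevel sets at all finite levels are
compact. -/
def IsRateFunction {X : Type*} [TopologicalSpace X] (I : X → ℝ≥0∞) : Prop :=
  ∀ M : ℝ≥0∞, M ≠ ⊤ → IsCompact {x | I x ≤ M}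

/-! ### The differential operator and the Hilbert space generated by its norm -/

/-- `(L f)(x) = ∑_{|α| ≤ r} A_α(x) (∂^α f(x))`, where the `A_α(x)` are linear maps of `ℝ³`, that
is, `3 × 3` matrices. -/
def diffOpApply (r : ℕ) (A : (Fin 3 → ℕ) → E3 → (E3 →ₗ[ℝ] E3)) (f : E3 → E3) (x : E3) : E3 :=
  ∑ α ∈ multiIdx r, A α x (multiD α f x)

/-- A linear differential operator of finite order on `[C₀^∞(O)]³`, given by its matrix
coefficients, which maps `[C₀^∞(O)]³` into `L²(O; ℝ³)` (so that `‖f‖_L` is defined). Elements of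
`[C₀^∞(O)]³` are regarded as functions on `ℝ³` that vanish outside `O`. -/
structure DiffOp (O : Opens E3) where
  order : ℕ
  coeff : (Fin 3 → ℕ) → E3 → (E3 →ₗ[ℝ] E3)
  memLp : ∀ f : 𝓓(O, E3), MemLp (diffOpApply order coeff f) 2 (volume.restrict (O : Set E3))

variable {O : Opens E3}

/-- The function `L f`. -/
def DiffOp.apply (L : DiffOp O) (f : 𝓓(O, E3)) : E3 → E3 := diffOpApply L.order L.coeff f

theorem DiffOp.apply_add (L : DiffOp O) (f g : 𝓓(O, E3)) :
    L.apply (f + g) = L.apply f + L.apply g := by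
  funext x
  have h (α : Fin 3 → ℕ) : multiD α ((f + g : 𝓓(O, E3)) : E3 → E3) =
      multiD α (f : E3 → E3) + multiD α (g : E3 → E3) := multiD_add f.contDiff g.contDiff α
  simp only [DiffOp.apply, diffOpApply, h, Pi.add_apply, map_add, Finset.sum_add_distrib]

theorem DiffOp.apply_smul (L : DiffOp O) (c : ℝ) (f : 𝓓(O, E3)) :
    L.apply (c • f) = c • L.apply f := by
  funext x
  have h (α : Fin 3 → ℕ) : multiD α ((c • f : 𝓓(O, E3)) : E3 → E3) =
      c • multiD α (f : E3 → E3) := multiD_smul f.contDiff c α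
  simp only [DiffOp.apply, diffOpApply, h, Pi.smul_apply, map_smul, Finset.smul_sum]

theorem DiffOp.integrable_inner (L : DiffOp O) (f g : 𝓓(O, E3)) :
    Integrable (fun x => inner ℝ (L.apply f x) (L.apply g x)) (volume.restrict (O : Set E3)) := by
  refine (L2.integrable_inner (𝕜 := ℝ) (L.memLp f).toLp (L.memLp g).toLp).congr ?_
  filter_upwards [(L.memLp f).coeFn_toLp, (L.memLp g).coeFn_toLp] with x h1 h2
  rw [h1, h2]
  rfl

/-- The vector space `[C₀^∞(O)]³`, to be equipped with the norm `‖·‖_L`. -/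
def PreH (_L : DiffOp O) : Type := 𝓓(O, E3)

variable (L : DiffOp O)

instance : AddCommGroup (PreH L) := inferInstanceAs (AddCommGroup 𝓓(O, E3))

instance : Module ℝ (PreH L) := inferInstanceAs (Module ℝ 𝓓(O, E3))

/-- The form `⟨f, g⟩_L = ∫_O ⟨L f(u), L g(u)⟩ du`. -/
@[reducible] def preCore : PreInnerProductSpace.Core ℝ (PreH L) where
  inner f g := ∫ u in (O : Set E3), inner ℝ (L.apply f u) (L.apply g u)
  conj_inner_symm f g := by simp [real_inner_comm]
  re_inner_nonneg f := by
    simp only [RCLike.re_to_real]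
    exact integral_nonneg fun u => real_inner_self_nonneg
  add_left f g h := by
    rw [← integral_add (L.integrable_inner f h) (L.integrable_inner g h)]
    congr 1
    funext u
    rw [← inner_add_left]
    exact congrArg (fun v => inner ℝ (v u) (L.apply h u)) (L.apply_add f g)
  smul_left f g c := by
    simp only [conj_trivial]
    rw [← integral_const_mul]
    congr 1
    funext u
    rw [← real_inner_smul_left]
    exact congrArg (fun v => inner ℝ (v u) (L.apply g u)) (L.apply_smul c f)

/-- The norm `‖·‖_L` (a priori a seminorm). -/
instance : SeminormedAddCommGroup (PreH L) :=
  InnerProductSpace.Core.toSeminormedAddCommGroup (c := preCore L)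

instance : InnerProductSpace ℝ (PreH L) := InnerProductSpace.ofCore (preCore L)

/-- The norm is `‖f‖_L² = ∑ᵢ ∫_O |(L f)ᵢ(u)|² du`. -/
theorem norm_preH_sq (f : PreH L) :
    ‖f‖ ^ 2 = ∫ u in (O : Set E3), ∑ i : Fin 3, (L.apply f u i) ^ 2 := by
  rw [← real_inner_self_eq_norm_sq]
  change ∫ u in (O : Set E3), inner ℝ (L.apply f u) (L.apply f u) = _
  simp [EuclideanSpace.norm_sq_eq]

/-- The Hilbert space `H`: the completion of `[C₀^∞(O)]³` with respect to `‖·‖_L`. -/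
abbrev HSpace : Type := UniformSpace.Completion (PreH L)

/-- The norm of `[W₀^{n,2}(O)]³` on `[C₀^∞(O)]³`:
`‖f‖² = ∑ᵢ ∫_O ∑_{|α| ≤ n} |∂^α fᵢ(u)|² du`. -/
def sobolevNorm (n : ℕ) (f : 𝓓(O, E3)) : ℝ :=
  Real.sqrt (∫ u in (O : Set E3), ∑ α ∈ multiIdx n, ‖multiD α f u‖ ^ 2)

variable {L}

/-- The value at `x` of the vector field represented by `z ∈ H`: the continuous extension to `H` of
the evaluation `f ↦ f(x)` on `[C₀^∞(O)]³`. (When `‖·‖_L` dominates a Sobolev norm of high order,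
the evaluation is uniformly continuous for `‖·‖_L`, and this is the embedding of `H` into a space
of continuous functions.) -/
def evalH (z : HSpace L) (x : E3) : E3 :=
  UniformSpace.Completion.extension
    (fun f : PreH L => (show 𝓓(O, E3) from f) x) z

/-! ### Flows of time-dependent vector fields in `H` -/

variable (L) in
/-- The Hilbert space `L²([0,1]; H)`. -/
abbrev VSpace : Type := Lp (HSpace L) 2 (volume.restrict (Icc (0 : ℝ) 1))

/-- `η` solves `∂η_t/∂t = ϑ(η_t, t)` on `[0, 1]` with `η_0 = x`, in the integrated
(Carathéodory) sense, as `ϑ` is only square integrable in time. -/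
def IsTrajectory (ϑ : VSpace L) (x : E3) (η : ℝ → E3) : Prop :=
  ContinuousOn η (Icc 0 1) ∧
  IntervalIntegrable (fun r => evalH (ϑ r) (η r)) volume 0 1 ∧
  ∀ t ∈ Icc (0 : ℝ) 1, η t = x + ∫ r in (0 : ℝ)..t, evalH (ϑ r) (η r)

open Classical in
/-- The time-one map `h_ϑ = η_{0,1}` of the flow of `ϑ` on `O`, extended to `ℝ³` by the identity
outside `O`. -/
def flowMap (ϑ : VSpace L) (x : E3) : E3 :=
  if h : x ∈ O ∧ ∃ η, IsTrajectory ϑ x η then h.2.choose 1 else x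

/-! ### The variational functional -/

variable {p : ℕ} {ι : Type*} [Fintype ι]

/-- `Y_d(x) = d_i` for `x ∈ X_i` (the sets `X_i` being disjoint). -/
def dataFn (X : ι → Set E3) (d : ι → EuclideanSpace ℝ (Fin p)) (x : E3) :
    EuclideanSpace ℝ (Fin p) :=
  ∑ i, (X i).indicator (fun _ => d i) x

/-- `J_d(ϑ) = ½ (‖ϑ‖² + ∫_O |T(h_ϑ(x)) - Y_d(x)|² dx)`. -/
def Jfun (T : E3 → EuclideanSpace ℝ (Fin p)) (X : ι → Set E3)
    (d : ι → EuclideanSpace ℝ (Fin p)) (ϑ : VSpace L) : ℝ≥0∞ :=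
  (1 / 2) * (‖ϑ‖ₑ ^ 2 + ∫⁻ x in (O : Set E3), ‖T (flowMap ϑ x) - dataFn X d x‖ₑ ^ 2)

variable (L)

/-- `Ĵ_d(h) = inf {J_d(ϑ) : h = h_ϑ}`, which is `∞` if there is no such `ϑ`. -/
def Jhat (T : E3 → EuclideanSpace ℝ (Fin p)) (X : ι → Set E3)
    (d : ι → EuclideanSpace ℝ (Fin p)) (h : E3 → E3) : ℝ≥0∞ :=
  ⨅ (ϑ : VSpace L) (_ : h = flowMap ϑ), Jfun T X d ϑ

/-- `λ_d = inf_{h ∈ G^n} Ĵ_d(h)`. -/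
def lam (n : ℕ) (T : E3 → EuclideanSpace ℝ (Fin p)) (X : ι → Set E3)
    (d : ι → EuclideanSpace ℝ (Fin p)) : ℝ≥0∞ :=
  ⨅ h : DiffeoGroup n, Jhat L T X d h

/-- `I_d(h) = Ĵ_d(h) - λ_d` on `G^n`. By definition `λ_d ≤ Ĵ_d(h)`, so that nothing is truncated
in the subtraction of `[0, ∞]` (as long as `λ_d` is finite). -/
def Ifun (n : ℕ) (T : E3 → EuclideanSpace ℝ (Fin p)) (X : ι → Set E3)
    (d : ι → EuclideanSpace ℝ (Fin p)) (h : DiffeoGroup n) : ℝ≥0∞ :=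
  Jhat L T X d h - lam L n T X d

end

end ImageMatching

open ImageMatching

/-! ### Superposition operators on spaces of continuous functions -/

namespace ImageMatching

section Superposition

universe u

variable {K : Type*} [TopologicalSpace K] [CompactSpace K]
  {E F : Type u} [NormedAddCommGroup E] [NormedSpace ℝ E] [NormedAddCommGroup F] [NormedSpace ℝ F]

/-! The domination of a Sobolev norm gives the evaluations enough regularity: with `n = k - 1`, the
map `x ↦ (z ↦ z(x))` from `ℝ³` to the bounded operators `H → ℝ³` is `C^{n+1}` in operator norm,
Lipschitz, and zero outside `O` (`nonempty_smoothEval`). The flow equation becomes `η(t) = x + ∫₀ᵗ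
A(η(r)) ϑ(r) dr`, which is linear in `ϑ`.

The main device is to solve this equation simultaneously for all controls in a ball. Let `W` be a
closed ball of `L²([0,1]; H)` with its weak topology, a compact Hausdorff space, and look for `η` in
the Banach space `C(W × [0,1], ℝ³)`. The operator `B ↦ ∫₀ᵗ B(w, r) θ_w(r) dr` is bounded on
continuous coefficients: for fixed `B` and `t` the integral is a continuous linear functional of the
control, so weak continuity suffices (`continuous_volterraIntegral`). Composition with `A` is
`C^{n+1}` between spaces of continuous functions (`contDiff_postcomp`), and an exponential weight in
time makes the whole nonlinearity a contraction (`lipschitzWith_volterra`). The inverse function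
theorem then shows that `x ↦ η` is `C^{n+1}` with values in `C(W × [0,1], ℝ³)`
(`exists_contDiff_solution`), so the `x`-derivatives of the flow are jointly continuous in `x` and
the weak parameter. Inverse flow maps are flow maps of time-reversed controls. Hence the flow map is
continuous from the weak ball to `G^n` (`SmoothEval.continuous_flowDiffeo`).

The functional `J_d` is weakly lower semicontinuous, by convexity of the norm and Fatou's lemma, and
its sublevel sets are bounded. So each set `{J_d ≤ c}` with `c < ∞` is weakly compact and its image
in `G^n` is compact. A sublevel set of `Ĵ_d` is an intersection of such images over levels
decreasing to the given one (`SmoothEval.setOf_Jhat_le`), hence compact; subtracting the finite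
number `λ_d` only shifts the level. -/

/-- The pointwise application of operators to vectors, as a continuous bilinear map. -/
noncomputable def pointwiseApply (K : Type*) [TopologicalSpace K] [CompactSpace K]
    (E F : Type u) [NormedAddCommGroup E] [NormedSpace ℝ E]
    [NormedAddCommGroup F] [NormedSpace ℝ F] :
    C(K, E →L[ℝ] F) →L[ℝ] C(K, E) →L[ℝ] C(K, F) :=
  LinearMap.mkContinuous₂
    (LinearMap.mk₂ ℝ
      (fun (B : C(K, E →L[ℝ] F)) (ξ : C(K, E)) =>
        (⟨fun k => B k (ξ k), B.continuous.clm_apply ξ.continuous⟩ : C(K, F)))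
      (fun B B' ξ => by ext; simp) (fun c B ξ => by ext; simp)
      (fun B ξ ξ' => by ext; simp) (fun c B ξ => by ext; simp))
    1 (fun B ξ => by
      refine (ContinuousMap.norm_le _ (by positivity)).2 fun k => ?_
      rw [one_mul]
      exact ((B k).le_opNorm _).trans (mul_le_mul (B.norm_coe_le_norm k) (ξ.norm_coe_le_norm k)
        (by positivity) (by positivity)))

@[simp] theorem pointwiseApply_apply (B : C(K, E →L[ℝ] F)) (ξ : C(K, E)) (k : K) :
    pointwiseApply K E F B ξ k = B k (ξ k) := rfl

/-- The range of `η` is compact, so `f'` is uniformly continuous at its points, even though `E` need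
not be locally compact. This makes the mean value remainder uniform in `k`. -/
theorem hasFDerivAt_postcomp (f : C(E, F)) (f' : C(E, E →L[ℝ] F))
    (hf : ∀ x, HasFDerivAt f (f' x) x) (η : C(K, E)) :
    HasFDerivAt (fun ξ : C(K, E) => f.comp ξ) (pointwiseApply K E F (f'.comp η)) η := by
  rw [hasFDerivAt_iff_isLittleO, Asymptotics.isLittleO_iff]
  intro ε hε
  have hU := (isCompact_range η.continuous).uniformContinuousAt_of_continuousAt f'
    (fun x _ => f'.continuous.continuousAt) (Metric.dist_mem_uniformity hε)
  obtain ⟨δ, hδ, hU⟩ := Metric.mem_uniformity_dist.1 hU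
  filter_upwards [Metric.ball_mem_nhds η hδ] with ξ hξ
  refine (ContinuousMap.norm_le _ (by positivity)).2 fun k => ?_
  have hk : ξ k ∈ Metric.ball (η k) δ :=
    Metric.mem_ball.2 ((ContinuousMap.dist_apply_le_dist k).trans_lt hξ)
  have h := (convex_ball (η k) δ).norm_image_sub_le_of_norm_hasFDerivWithin_le'
    (f := f) (f' := f') (φ := f' (η k)) (C := ε) (fun x _ => (hf x).hasFDerivWithinAt)
    (fun x hx => by
      rw [← dist_eq_norm, dist_comm]
      exact (hU (by rwa [dist_comm]) ⟨k, rfl⟩).le)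
    (Metric.mem_ball_self hδ) hk
  refine h.trans (mul_le_mul_of_nonneg_left ?_ hε.le)
  exact (ξ - η).norm_coe_le_norm k

/-- The derivative is the superposition operator of `f'` followed by a bounded linear map, which
feeds the induction. The target changes from `F` to `E →L[ℝ] F`; this is why `E` and `F` share a
universe. -/
theorem contDiff_postcomp (n : ℕ) (f : C(E, F)) (hf : ContDiff ℝ n f) :
    ContDiff ℝ n (fun ξ : C(K, E) => f.comp ξ) := by
  induction n generalizing F with
  | zero => exact contDiff_zero.2 (ContinuousMap.continuous_postcomp f)
  | succ n ih =>
    obtain ⟨f', hf', hd⟩ := contDiff_succ_iff_hasFDerivAt.1 hf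
    refine contDiff_succ_iff_hasFDerivAt.2
      ⟨_, ?_, hasFDerivAt_postcomp f ⟨f', hf'.continuous⟩ hd⟩
    exact (pointwiseApply K E F).contDiff.comp (ih ⟨f', hf'.continuous⟩ hf')

end Superposition

end ImageMatching

/-! ### Estimates for square integrable curves -/

namespace ImageMatching

section SquareIntegrable

variable {H E : Type*} [NormedAddCommGroup H]

theorem integrable_norm_sq_L2 (v : Lp H 2 (volume.restrict (Icc (0 : ℝ) 1))) :
    Integrable (fun r => ‖v r‖ ^ 2) (volume.restrict (Icc (0 : ℝ) 1)) :=
  (Lp.memLp v).integrable_norm_pow (by norm_num)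

theorem integrable_L2 (v : Lp H 2 (volume.restrict (Icc (0 : ℝ) 1))) :
    Integrable v (volume.restrict (Icc (0 : ℝ) 1)) :=
  (Lp.memLp v).integrable (by norm_num)

theorem intervalIntegrable_mul_norm_L2 (v : Lp H 2 (volume.restrict (Icc (0 : ℝ) 1)))
    {g : ℝ → ℝ} (hg : Continuous g) {s t : ℝ} (hs : s ∈ Icc (0 : ℝ) 1)
    (ht : t ∈ Icc (0 : ℝ) 1) : IntervalIntegrable (fun r => g r * ‖v r‖) volume s t := by
  have h : IntervalIntegrable (fun r => ‖v r‖) volume s t :=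
    (IntegrableOn.mono_set (integrable_L2 v).norm (uIcc_subset_Icc hs ht)).intervalIntegrable
  exact h.continuousOn_mul hg.continuousOn

variable [InnerProductSpace ℝ H] [NormedAddCommGroup E] [NormedSpace ℝ E]

theorem integral_norm_sq_L2 (v : Lp H 2 (volume.restrict (Icc (0 : ℝ) 1))) :
    ∫ r in Icc (0 : ℝ) 1, ‖v r‖ ^ 2 = ‖v‖ ^ 2 := by
  rw [← real_inner_self_eq_norm_sq, L2.inner_def]
  simp only [real_inner_self_eq_norm_sq]

theorem integrable_clm_apply_L2 (v : Lp H 2 (volume.restrict (Icc (0 : ℝ) 1)))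
    {b : ℝ → H →L[ℝ] E} (hb : Continuous b) :
    Integrable (fun r => b r (v r)) (volume.restrict (Icc (0 : ℝ) 1)) := by
  obtain ⟨C, hC⟩ := (isCompact_Icc (a := (0 : ℝ)) (b := 1)).bddAbove_image hb.norm.continuousOn
  refine ((integrable_L2 v).norm.const_mul C).mono' ?_ ?_
  · exact isBoundedBilinearMap_apply.continuous.comp_aestronglyMeasurable₂
      hb.aestronglyMeasurable (Lp.aestronglyMeasurable v)
  · refine (ae_restrict_mem measurableSet_Icc).mono fun r hr => ?_
    exact ((b r).le_opNorm _).trans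
      (mul_le_mul_of_nonneg_right (hC ⟨r, hr, rfl⟩) (norm_nonneg _))

theorem intervalIntegrable_clm_apply_L2 (v : Lp H 2 (volume.restrict (Icc (0 : ℝ) 1)))
    {b : ℝ → H →L[ℝ] E} (hb : Continuous b) {s t : ℝ} (hs : s ∈ Icc (0 : ℝ) 1)
    (ht : t ∈ Icc (0 : ℝ) 1) : IntervalIntegrable (fun r => b r (v r)) volume s t := by
  refine (IntegrableOn.mono_set (integrable_clm_apply_L2 v hb) ?_).intervalIntegrable
  exact uIcc_subset_Icc hs ht

/-- Cauchy–Schwarz. The weight `g = 1` yields the modulus of continuity `√(t - s)` in time, and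
exponential `g` yields the contraction estimate. -/
theorem integral_mul_norm_L2_le (v : Lp H 2 (volume.restrict (Icc (0 : ℝ) 1)))
    {g : ℝ → ℝ} (hg : Continuous g) (hg0 : ∀ r, 0 ≤ g r) {s t : ℝ} (hs : s ∈ Icc (0 : ℝ) 1)
    (ht : t ∈ Icc (0 : ℝ) 1) (hst : s ≤ t) :
    ∫ r in s..t, g r * ‖v r‖ ≤ Real.sqrt (∫ r in s..t, g r ^ 2) * ‖v‖ := by
  have hsub : Ioc s t ⊆ Icc (0 : ℝ) 1 := fun r hr => ⟨hs.1.trans hr.1.le, hr.2.trans ht.2⟩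
  have hle : volume.restrict (Ioc s t) ≤ volume.restrict (Icc (0 : ℝ) 1) :=
    Measure.restrict_mono_set _ hsub
  rw [intervalIntegral.integral_of_le hst, intervalIntegral.integral_of_le hst]
  have hgm : MemLp g (ENNReal.ofReal 2) (volume.restrict (Ioc s t)) := by
    obtain ⟨C, hC⟩ := (isCompact_Icc (a := s) (b := t)).bddAbove_image hg.norm.continuousOn
    exact MemLp.of_bound hg.aestronglyMeasurable C ((ae_restrict_mem measurableSet_Ioc).mono
      fun r hr => hC ⟨r, Ioc_subset_Icc_self hr, rfl⟩)
  have hvm : MemLp (fun r => ‖v r‖) (ENNReal.ofReal 2) (volume.restrict (Ioc s t)) := by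
    rw [ENNReal.ofReal_ofNat]
    exact ((Lp.memLp v).mono_measure hle).norm
  have h := integral_mul_le_Lp_mul_Lq_of_nonneg (μ := volume.restrict (Ioc s t))
    (p := 2) (q := 2) ⟨by norm_num, by norm_num, by norm_num⟩ (ae_of_all _ hg0)
    (ae_of_all _ fun r => norm_nonneg (v r)) hgm hvm
  refine h.trans ?_
  simp only [Real.rpow_two, ← Real.sqrt_eq_rpow]
  refine mul_le_mul_of_nonneg_left ?_ (Real.sqrt_nonneg _)
  refine Real.sqrt_le_iff.2 ⟨norm_nonneg _, ?_⟩
  rw [← integral_norm_sq_L2]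
  exact integral_mono_measure hle (ae_of_all _ fun r => by positivity) (integrable_norm_sq_L2 v)

theorem integral_norm_L2_le (v : Lp H 2 (volume.restrict (Icc (0 : ℝ) 1)))
    {s t : ℝ} (hs : s ∈ Icc (0 : ℝ) 1) (ht : t ∈ Icc (0 : ℝ) 1) (hst : s ≤ t) :
    ∫ r in s..t, ‖v r‖ ≤ Real.sqrt (t - s) * ‖v‖ := by
  simpa using integral_mul_norm_L2_le v (g := fun _ => 1) continuous_const
    (fun _ => zero_le_one) hs ht hst

theorem norm_integral_clm_apply_L2_le (v : Lp H 2 (volume.restrict (Icc (0 : ℝ) 1)))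
    {b : ℝ → H →L[ℝ] E} {C : ℝ} (hC : ∀ r, ‖b r‖ ≤ C) {s t : ℝ}
    (hs : s ∈ Icc (0 : ℝ) 1) (ht : t ∈ Icc (0 : ℝ) 1) :
    ‖∫ r in s..t, b r (v r)‖ ≤ C * (Real.sqrt |t - s| * ‖v‖) := by
  have hC0 : 0 ≤ C := (norm_nonneg _).trans (hC 0)
  wlog hst : s ≤ t generalizing s t
  · rw [intervalIntegral.integral_symm, norm_neg, abs_sub_comm]
    exact this ht hs (le_of_not_ge hst)
  rw [abs_of_nonneg (sub_nonneg.2 hst)]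
  refine (intervalIntegral.norm_integral_le_of_norm_le (g := fun r => C * ‖v r‖) hst
    (ae_of_all _ fun r _ => ((b r).le_opNorm _).trans
      (mul_le_mul_of_nonneg_right (hC r) (norm_nonneg _)))
    (intervalIntegrable_mul_norm_L2 v continuous_const hs ht)).trans ?_
  rw [intervalIntegral.integral_const_mul]
  exact mul_le_mul_of_nonneg_left (integral_norm_L2_le v hs ht hst) hC0

/-- The functional `v ↦ ∫₀ᵗ b(r) v(r) dr` on `L²([0,1]; H)`. -/
noncomputable def integralFunctional {b : ℝ → H →L[ℝ] E} (hb : Continuous b) {C : ℝ}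
    (hC : ∀ r, ‖b r‖ ≤ C) {t : ℝ} (ht : t ∈ Icc (0 : ℝ) 1) :
    Lp H 2 (volume.restrict (Icc (0 : ℝ) 1)) →L[ℝ] E :=
  LinearMap.mkContinuous
    { toFun := fun v => ∫ r in (0 : ℝ)..t, b r (v r)
      map_add' := fun v v' => by
        have h0 : (0 : ℝ) ∈ Icc (0 : ℝ) 1 := by simp
        rw [← intervalIntegral.integral_add (intervalIntegrable_clm_apply_L2 v hb h0 ht)
          (intervalIntegrable_clm_apply_L2 v' hb h0 ht)]
        refine intervalIntegral.integral_congr_ae_restrict ?_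
        rw [uIoc_of_le ht.1]
        have hsub : Ioc 0 t ⊆ Icc (0 : ℝ) 1 := fun r hr => ⟨hr.1.le, hr.2.trans ht.2⟩
        filter_upwards [ae_restrict_of_ae_restrict_of_subset hsub (Lp.coeFn_add v v')] with r hr
        rw [hr, Pi.add_apply, map_add]
      map_smul' := fun c v => by
        rw [RingHom.id_apply, ← intervalIntegral.integral_smul]
        refine intervalIntegral.integral_congr_ae_restrict ?_
        rw [uIoc_of_le ht.1]
        have hsub : Ioc 0 t ⊆ Icc (0 : ℝ) 1 := fun r hr => ⟨hr.1.le, hr.2.trans ht.2⟩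
        filter_upwards [ae_restrict_of_ae_restrict_of_subset hsub (Lp.coeFn_smul c v)] with r hr
        rw [hr, Pi.smul_apply, map_smul] }
    (C * Real.sqrt |t - 0|) fun v => by
      rw [mul_assoc]
      exact norm_integral_clm_apply_L2_le v hC (by simp) ht

end SquareIntegrable

end ImageMatching

/-! ### Volterra equations with a weakly continuous family of square integrable coefficients -/

namespace ImageMatching

open Filter Topology

universe u

section Volterra

variable {H E : Type u} [NormedAddCommGroup H] [InnerProductSpace ℝ H]
  [NormedAddCommGroup E] [NormedSpace ℝ E]
  {W : Type*} [TopologicalSpace W] [CompactSpace W]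

/-- The section `r ↦ B(w, r)` of a function on `W × [0, 1]`, extended to `r ∈ ℝ` by projection
to `[0, 1]`. -/
noncomputable def slice {F : Type*} [TopologicalSpace F] (B : C(W × Icc (0 : ℝ) 1, F)) (w : W) (r : ℝ) : F :=
  B (w, projIcc 0 1 zero_le_one r)

omit [CompactSpace W] in
theorem continuous_slice {F : Type*} [TopologicalSpace F] (B : C(W × Icc (0 : ℝ) 1, F)) (w : W) :
    Continuous (slice B w) :=
  B.continuous.comp (continuous_const.prodMk continuous_projIcc)

theorem norm_slice_le {F : Type*} [NormedAddCommGroup F] (B : C(W × Icc (0 : ℝ) 1, F)) (w : W)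
    (r : ℝ) : ‖slice B w r‖ ≤ ‖B‖ := B.norm_coe_le_norm _

omit [CompactSpace W] in
-- Weak continuity is tested on scalar functionals; coordinates transfer it to values in a
-- finite-dimensional space.
theorem continuous_clm_apply_of_weakly_continuous [FiniteDimensional ℝ E]
    {V : Type*} [NormedAddCommGroup V] [NormedSpace ℝ V] {θ : W → V}
    (hθ : ∀ ℓ : V →L[ℝ] ℝ, Continuous fun w => ℓ (θ w)) (ℓ : V →L[ℝ] E) :
    Continuous fun w => ℓ (θ w) := by
  let e := (Module.finBasis ℝ E).equivFunL
  have h : Continuous fun w => e (ℓ (θ w)) := continuous_pi fun i => by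
    let ℓ' : V →L[ℝ] ℝ := (ContinuousLinearMap.proj (R := ℝ) (φ := fun _ => ℝ) i).comp
      ((e : E →L[ℝ] _).comp ℓ)
    exact hθ ℓ'
  simpa [Function.comp_def] using e.symm.continuous.comp h

variable {θ : W → Lp H 2 (volume.restrict (Icc (0 : ℝ) 1))} {R : ℝ}

/-- The increment splits into a change of the upper limit, a change of the coefficient and a change
of the control. The first two are small by the uniform bound on `‖θ w‖`; only the third uses weak
continuity, with coefficient and limit frozen. -/
theorem continuous_volterraIntegral [FiniteDimensional ℝ E] (hR : ∀ w, ‖θ w‖ ≤ R)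
    (hθ : ∀ ℓ : Lp H 2 (volume.restrict (Icc (0 : ℝ) 1)) →L[ℝ] ℝ, Continuous fun w => ℓ (θ w))
    (B : C(W × Icc (0 : ℝ) 1, H →L[ℝ] E)) :
    Continuous fun p : W × Icc (0 : ℝ) 1 =>
      ∫ r in (0 : ℝ)..p.2, slice B p.1 r (θ p.1 r) := by
  have h0 : (0 : ℝ) ∈ Icc (0 : ℝ) 1 := by simp
  refine continuous_iff_continuousAt.2 fun p₀ => ?_
  obtain ⟨w₀, t₀⟩ := p₀
  have hi := fun (w : W) (t : Icc (0 : ℝ) 1) (w' : W) =>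
    intervalIntegrable_clm_apply_L2 (θ w) (continuous_slice B w') h0 t.2
  have h3 : Tendsto (fun p : W × Icc (0 : ℝ) 1 => ∫ r in (0 : ℝ)..t₀, slice B w₀ r (θ p.1 r))
      (𝓝 (w₀, t₀)) (𝓝 (∫ r in (0 : ℝ)..t₀, slice B w₀ r (θ w₀ r))) :=
    ((continuous_clm_apply_of_weakly_continuous hθ
      (integralFunctional (continuous_slice B w₀) (norm_slice_le B w₀) t₀.2)).comp
        continuous_fst).continuousAt
  have h2 : Tendsto (fun p : W × Icc (0 : ℝ) 1 =>
      ∫ r in (0 : ℝ)..t₀, (slice B p.1 r - slice B w₀ r) (θ p.1 r)) (𝓝 (w₀, t₀)) (𝓝 0) := by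
    have hc : Tendsto (fun p : W × Icc (0 : ℝ) 1 => dist (B.curry p.1) (B.curry w₀) *
        (Real.sqrt |(t₀ : ℝ) - 0| * R)) (𝓝 (w₀, t₀)) (𝓝 0) := by
      -- Currying turns joint continuity into uniform closeness over the compact time interval.
      have hcur : Continuous fun p : W × Icc (0 : ℝ) 1 => B.curry p.1 :=
        B.curry.continuous.comp continuous_fst
      have : Continuous fun p : W × Icc (0 : ℝ) 1 => dist (B.curry p.1) (B.curry w₀) *
        (Real.sqrt |(t₀ : ℝ) - 0| * R) := by fun_prop
      have h := this.tendsto (w₀, t₀)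
      rwa [dist_self, zero_mul] at h
    refine squeeze_zero_norm (fun p => ?_) hc
    refine (norm_integral_clm_apply_L2_le (θ p.1) (C := dist (B.curry p.1) (B.curry w₀))
      (fun r => by
        rw [← dist_eq_norm]
        exact ContinuousMap.dist_apply_le_dist (f := B.curry p.1) (g := B.curry w₀) _) h0 t₀.2).trans ?_
    gcongr
    exact hR _
  have h1 : Tendsto (fun p : W × Icc (0 : ℝ) 1 =>
      ∫ r in (t₀ : ℝ)..p.2, slice B p.1 r (θ p.1 r)) (𝓝 (w₀, t₀)) (𝓝 0) := by
    have hc : Tendsto (fun p : W × Icc (0 : ℝ) 1 =>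
        ‖B‖ * (Real.sqrt |(p.2 : ℝ) - t₀| * R)) (𝓝 (w₀, t₀)) (𝓝 0) := by
      have : Continuous fun p : W × Icc (0 : ℝ) 1 =>
        ‖B‖ * (Real.sqrt |(p.2 : ℝ) - t₀| * R) := by fun_prop
      simpa using this.tendsto (w₀, t₀)
    refine squeeze_zero_norm (fun p => ?_) hc
    refine (norm_integral_clm_apply_L2_le (θ p.1) (norm_slice_le B p.1) t₀.2 p.2.2).trans ?_
    gcongr
    exact hR _
  have h := (h1.add h2).add h3
  rw [zero_add, zero_add] at h
  refine h.congr fun p => ?_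
  simp only [sub_apply]
  rw [intervalIntegral.integral_sub (hi p.1 t₀ p.1) (hi p.1 t₀ w₀),
    ← intervalIntegral.integral_add_adjacent_intervals (hi p.1 t₀ p.1)
      (intervalIntegrable_clm_apply_L2 (θ p.1) (continuous_slice B p.1) t₀.2 p.2.2)]
  abel

/-- The operator `B ↦ ((w, t) ↦ ∫₀ᵗ B(w, r) θ_w(r) dr)`. -/
noncomputable def volterraIntegral [FiniteDimensional ℝ E] (hR : ∀ w, ‖θ w‖ ≤ R)
    (hθ : ∀ ℓ : Lp H 2 (volume.restrict (Icc (0 : ℝ) 1)) →L[ℝ] ℝ, Continuous fun w => ℓ (θ w)) :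
    C(W × Icc (0 : ℝ) 1, H →L[ℝ] E) →L[ℝ] C(W × Icc (0 : ℝ) 1, E) :=
  LinearMap.mkContinuous (E := C(W × Icc (0 : ℝ) 1, H →L[ℝ] E)) (F := C(W × Icc (0 : ℝ) 1, E))
    (σ := RingHom.id ℝ)
    { toFun := fun B => ⟨_, continuous_volterraIntegral hR hθ B⟩
      map_add' := fun B B' => by
        ext p
        exact intervalIntegral.integral_add
          (intervalIntegrable_clm_apply_L2 _ (continuous_slice B p.1) (by simp) p.2.2)
          (intervalIntegrable_clm_apply_L2 _ (continuous_slice B' p.1) (by simp) p.2.2)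
      map_smul' := fun c B => by
        ext p
        exact intervalIntegral.integral_smul c _ }
    -- The absolute value is needed because `W` may be empty, and then `R` may be negative.
    |R| fun B => by
      refine (ContinuousMap.norm_le _ (by positivity)).2 fun p => ?_
      refine (norm_integral_clm_apply_L2_le (θ p.1) (norm_slice_le B p.1) (by simp) p.2.2).trans ?_
      rw [mul_comm |R|]
      refine mul_le_mul_of_nonneg_left ?_ (norm_nonneg _)
      have h1 : Real.sqrt |(p.2 : ℝ) - 0| ≤ 1 := by
        rw [sub_zero, abs_of_nonneg p.2.2.1]
        exact Real.sqrt_le_one.2 p.2.2.2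
      calc Real.sqrt |(p.2 : ℝ) - 0| * ‖θ p.1‖ ≤ 1 * |R| :=
            mul_le_mul h1 ((hR _).trans (le_abs_self R)) (norm_nonneg _) zero_le_one
        _ = |R| := one_mul _

theorem volterraIntegral_apply [FiniteDimensional ℝ E] (hR : ∀ w, ‖θ w‖ ≤ R)
    (hθ : ∀ ℓ : Lp H 2 (volume.restrict (Icc (0 : ℝ) 1)) →L[ℝ] ℝ, Continuous fun w => ℓ (θ w))
    (B : C(W × Icc (0 : ℝ) 1, H →L[ℝ] E)) (p : W × Icc (0 : ℝ) 1) :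
    volterraIntegral hR hθ B p = ∫ r in (0 : ℝ)..p.2, slice B p.1 r (θ p.1 r) := rfl

/-- Multiplication by `e^{c t}` on functions of `(w, t)`. -/
noncomputable def expMul (W : Type*) [TopologicalSpace W] [CompactSpace W] (E : Type u)
    [NormedAddCommGroup E] [NormedSpace ℝ E] (c : ℝ) :
    C(W × Icc (0 : ℝ) 1, E) →L[ℝ] C(W × Icc (0 : ℝ) 1, E) :=
  pointwiseApply (W × Icc (0 : ℝ) 1) E E
    ⟨fun p => Real.exp (c * p.2) • ContinuousLinearMap.id ℝ E, by fun_prop⟩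

@[simp] theorem expMul_apply (c : ℝ) (ζ : C(W × Icc (0 : ℝ) 1, E)) (p : W × Icc (0 : ℝ) 1) :
    expMul W E c ζ p = Real.exp (c * p.2) • ζ p := rfl

theorem expMul_neg_expMul (c : ℝ) (ζ : C(W × Icc (0 : ℝ) 1, E)) :
    expMul W E (-c) (expMul W E c ζ) = ζ := by
  ext p
  simp [smul_smul, ← Real.exp_add]

theorem expMul_expMul_neg (c : ℝ) (ζ : C(W × Icc (0 : ℝ) 1, E)) :
    expMul W E c (expMul W E (-c) ζ) = ζ := by
  ext p
  simp [smul_smul, ← Real.exp_add]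

theorem sqrt_integral_exp_sq_le {c t : ℝ} (hc : 0 < c) :
    Real.sqrt (∫ r in (0 : ℝ)..t, Real.exp (c * r) ^ 2) ≤
      Real.exp (c * t) / Real.sqrt (2 * c) := by
  have h : ∫ r in (0 : ℝ)..t, Real.exp (c * r) ^ 2 =
      (Real.exp (c * t) ^ 2 - 1) / (2 * c) := by
    have : ∀ r, Real.exp (c * r) ^ 2 = Real.exp (2 * c * r) := fun r => by
      rw [← Real.exp_nat_mul]; congr 1; push_cast; ring
    simp only [this]
    rw [intervalIntegral.integral_comp_mul_left (fun x => Real.exp x) (by positivity),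
      integral_exp]
    simp only [smul_eq_mul, mul_zero, Real.exp_zero]
    field_simp
  rw [h]
  calc Real.sqrt ((Real.exp (c * t) ^ 2 - 1) / (2 * c))
      ≤ Real.sqrt (Real.exp (c * t) ^ 2 / (2 * c)) := by
        refine Real.sqrt_le_sqrt ?_
        gcongr
        linarith
    _ = Real.exp (c * t) / Real.sqrt (2 * c) := by
        rw [Real.sqrt_div (by positivity), Real.sqrt_sq (by positivity)]

/-- Conjugation with `e^{ct}` amounts to the sup norm weighted by `e^{-ct}`. By Cauchy–Schwarz in
time the Lipschitz constant is at most `K R / √(2c)`, which is at most `1/2` once `c ≥ 2 (K R)²`;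
the extra `1` keeps `c` positive. -/
theorem lipschitzWith_volterra [FiniteDimensional ℝ E] (hR : ∀ w, ‖θ w‖ ≤ R)
    (hθ : ∀ ℓ : Lp H 2 (volume.restrict (Icc (0 : ℝ) 1)) →L[ℝ] ℝ, Continuous fun w => ℓ (θ w))
    (A : C(E, H →L[ℝ] E)) {K : ℝ≥0} (hA : LipschitzWith K A) {c : ℝ}
    (hc : 2 * (K * R) ^ 2 + 1 ≤ c) :
    LipschitzWith (1 / 2 : ℝ≥0) fun ζ : C(W × Icc (0 : ℝ) 1, E) =>
      expMul W E (-c) (volterraIntegral hR hθ (A.comp (expMul W E c ζ))) := by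
  have hc0 : 0 < c := by nlinarith [sq_nonneg (K * R)]
  refine LipschitzWith.of_dist_le_mul fun ζ ζ' => ?_
  refine (ContinuousMap.dist_le (by positivity)).2 fun p => ?_
  obtain ⟨w, t⟩ := p
  have hR0 : 0 ≤ R := (norm_nonneg _).trans (hR w)
  rw [dist_eq_norm, expMul_apply, expMul_apply, ← smul_sub, norm_smul, Real.norm_eq_abs,
    abs_of_pos (Real.exp_pos _), volterraIntegral_apply, volterraIntegral_apply,
    ← intervalIntegral.integral_sub
      (intervalIntegrable_clm_apply_L2 _ (continuous_slice _ w) (by simp) t.2)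
      (intervalIntegrable_clm_apply_L2 _ (continuous_slice _ w) (by simp) t.2)]
  have hpt : ∀ r ∈ Ioc (0 : ℝ) t,
      ‖slice (A.comp (expMul W E c ζ)) w r (θ w r) - slice (A.comp (expMul W E c ζ')) w r (θ w r)‖
        ≤ (K * dist ζ ζ') * (Real.exp (c * r) * ‖θ w r‖) := by
    intro r hr
    have hr' : r ∈ Icc (0 : ℝ) 1 := ⟨hr.1.le, hr.2.trans t.2.2⟩
    rw [← sub_apply]
    refine (ContinuousLinearMap.le_opNorm _ _).trans ?_
    rw [← mul_assoc]
    refine mul_le_mul_of_nonneg_right ?_ (norm_nonneg _)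
    rw [← dist_eq_norm]
    refine (hA.dist_le_mul _ _).trans ?_
    rw [mul_assoc]
    refine mul_le_mul_of_nonneg_left ?_ K.2
    rw [expMul_apply, expMul_apply, dist_smul₀, Real.norm_eq_abs, abs_of_pos (Real.exp_pos _),
      projIcc_of_mem _ hr', mul_comm]
    exact mul_le_mul_of_nonneg_right (ContinuousMap.dist_apply_le_dist _) (Real.exp_pos _).le
  have hexp : Continuous fun r : ℝ => Real.exp (c * r) := by fun_prop
  have hint := intervalIntegral.norm_integral_le_of_norm_le t.2.1 (ae_of_all _ hpt)
    ((intervalIntegrable_mul_norm_L2 (θ w) hexp (by simp) t.2).const_mul _)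
  rw [intervalIntegral.integral_const_mul] at hint
  have hcs := (integral_mul_norm_L2_le (θ w) hexp (fun r => (Real.exp_pos _).le)
    (by simp) t.2 t.2.1).trans
      (mul_le_mul (sqrt_integral_exp_sq_le (t := t) hc0) (hR w) (norm_nonneg _) (by positivity))
  have hs : K * R ≤ Real.sqrt (2 * c) / 2 := by
    rw [le_div_iff₀ two_pos]
    refine Real.le_sqrt_of_sq_le ?_
    nlinarith
  calc Real.exp (-c * t) * _
      ≤ Real.exp (-c * t) * (K * dist ζ ζ' *
          (Real.exp (c * t) / Real.sqrt (2 * c) * R)) := by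
        refine mul_le_mul_of_nonneg_left (hint.trans ?_) (Real.exp_pos _).le
        exact mul_le_mul_of_nonneg_left hcs (by positivity)
    _ = (K * R) / Real.sqrt (2 * c) * dist ζ ζ' := by
        rw [neg_mul, Real.exp_neg]
        field_simp
    _ ≤ _ := by
        refine mul_le_mul_of_nonneg_right ?_ dist_nonneg
        rw [div_le_iff₀ (by positivity)]
        simpa [div_eq_inv_mul] using hs

/-- A nonlinear perturbation of the identity of Lipschitz constant `1/2` which is of class `C^n`
is a `C^n` diffeomorphism. -/
theorem exists_contDiff_inverse {Z : Type*} [NormedAddCommGroup Z] [NormedSpace ℝ Z]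
    [CompleteSpace Z] {N : Z → Z} {n : ℕ} (hN : ContDiff ℝ (n + 1 : ℕ) N)
    (hL : LipschitzWith (1 / 2 : ℝ≥0) N) :
    ∃ G : Z → Z, ContDiff ℝ (n + 1 : ℕ) G ∧ ∀ z y, z = G y ↔ z - N z = y := by
  -- The map approximates the identity on the whole space with constant `1/2 < 1`, so it is a global
  -- homeomorphism.
  have happ : ApproximatesLinearOn (fun z => z - N z)
      ((ContinuousLinearEquiv.refl ℝ Z : Z ≃L[ℝ] Z) : Z →L[ℝ] Z) univ (1 / 2 : ℝ≥0) := by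
    intro x _ y _
    have h := hL.dist_le_mul y x
    rw [dist_eq_norm, dist_comm, dist_eq_norm] at h
    have e : x - N x - (y - N y) - (x - y) = N y - N x := by abel
    change ‖x - N x - (y - N y) - (x - y)‖ ≤ _
    rw [e]
    exact h
  have hsm : Subsingleton Z ∨ (1 / 2 : ℝ≥0) <
      ‖((ContinuousLinearEquiv.refl ℝ Z).symm : Z →L[ℝ] Z)‖₊⁻¹ := by
    rcases subsingleton_or_nontrivial Z with hZ | hZ
    · exact Or.inl hZ
    right
    have : ‖((ContinuousLinearEquiv.refl ℝ Z).symm : Z →L[ℝ] Z)‖₊ = 1 :=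
      ContinuousLinearMap.nnnorm_id
    rw [this, inv_one]
    exact NNReal.half_lt_self one_ne_zero
  let Ψ := happ.toHomeomorph _ hsm
  have hΨ : ∀ z, Ψ z = z - N z := fun z => rfl
  have hd : ∀ z, ‖fderiv ℝ N z‖ < 1 := fun z =>
    ((hN.differentiable (by simp) z).hasFDerivAt.le_of_lipschitz hL).trans_lt (by norm_num)
  -- The derivative `1 - DN(z)` is invertible by the Neumann series, so the inverse inherits the
  -- smoothness.
  have hder : ∀ z, HasFDerivAt Ψ
      ((ContinuousLinearEquiv.ofUnit (Units.oneSub (fderiv ℝ N z) (hd z)) : Z ≃L[ℝ] Z) :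
        Z →L[ℝ] Z) z := fun z =>
    (hasFDerivAt_id z).sub (hN.differentiable (by simp) z).hasFDerivAt
  refine ⟨Ψ.symm, Ψ.contDiff_symm hder (contDiff_id.sub hN), fun z y => ?_⟩
  rw [← hΨ]
  constructor <;> rintro rfl <;> simp

/-- The solutions of `η(w, t) = x + ∫₀ᵗ A(η(w, r)) θ_w(r) dr` exist, are unique, and depend
smoothly on `x`, uniformly in the parameter `w`. -/
theorem exists_contDiff_solution [FiniteDimensional ℝ E] (hR : ∀ w, ‖θ w‖ ≤ R)
    (hθ : ∀ ℓ : Lp H 2 (volume.restrict (Icc (0 : ℝ) 1)) →L[ℝ] ℝ, Continuous fun w => ℓ (θ w))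
    (A : C(E, H →L[ℝ] E)) {K : ℝ≥0} (hA : LipschitzWith K A) {n : ℕ}
    (hAn : ContDiff ℝ (n + 1 : ℕ) A) :
    ∃ Y : E → C(W × Icc (0 : ℝ) 1, E), ContDiff ℝ (n + 1 : ℕ) Y ∧ ∀ x η,
      η = Y x ↔ ∀ p : W × Icc (0 : ℝ) 1,
        η p = x + ∫ r in (0 : ℝ)..p.2, A (slice η p.1 r) (θ p.1 r) := by
  set c : ℝ := 2 * (K * R) ^ 2 + 1
  have hN : ContDiff ℝ (n + 1 : ℕ) fun ζ : C(W × Icc (0 : ℝ) 1, E) =>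
      expMul W E (-c) (volterraIntegral hR hθ (A.comp (expMul W E c ζ))) := by
    have h1 : ContDiff ℝ (n + 1 : ℕ) fun ζ : C(W × Icc (0 : ℝ) 1, E) =>
        A.comp (expMul W E c ζ) :=
      (contDiff_postcomp (n + 1) A hAn).comp (expMul W E c).contDiff
    have h2 := (volterraIntegral (E := E) hR hθ).contDiff.comp h1
    exact (expMul W E (-c)).contDiff.comp h2
  obtain ⟨G, hG, hGe⟩ := exists_contDiff_inverse hN (lipschitzWith_volterra hR hθ A hA le_rfl)
  let κ : E →L[ℝ] C(W × Icc (0 : ℝ) 1, E) := LinearMap.mkContinuous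
    { toFun := fun x => ContinuousMap.const _ x
      map_add' := fun _ _ => rfl
      map_smul' := fun _ _ => rfl } 1 fun x => by
        refine (ContinuousMap.norm_le _ (by positivity)).2 fun p => ?_
        rw [one_mul]
        exact le_rfl
  refine ⟨fun x => expMul W E c (G (expMul W E (-c) (κ x))), (expMul W E c).contDiff.comp
    (hG.comp ((expMul W E (-c)).contDiff.comp κ.contDiff)), fun x η => ?_⟩
  have hκ : ∀ p, κ x p = x := fun p => rfl
  -- The substitution `η = e^{ct} ζ` turns the integral equation into `ζ - N ζ = e^{-ct} x`.
  have h1 : η = expMul W E c (G (expMul W E (-c) (κ x))) ↔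
      expMul W E (-c) η = G (expMul W E (-c) (κ x)) := by
    constructor
    · intro h
      rw [h, expMul_neg_expMul]
    · intro h
      rw [← h, expMul_expMul_neg]
  rw [h1, hGe, expMul_expMul_neg, ← map_sub]
  constructor
  · intro h p
    have h' := congrArg (expMul W E c) h
    rw [expMul_expMul_neg, expMul_expMul_neg, sub_eq_iff_eq_add] at h'
    exact congrFun (congrArg DFunLike.coe h') p
  · intro h
    congr 1
    rw [sub_eq_iff_eq_add]
    ext1 p
    exact h p

end Volterra

end ImageMatching

/-! ### Flows of square integrable curves of smooth vector fields -/

namespace ImageMatching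

open Filter Topology

/-- The evaluation of elements of `H` as a map of class `C^{n+1}` from points to bounded operators,
which is Lipschitz and vanishes outside `O`. -/
structure SmoothEval {O : Opens E3} (L : DiffOp O) (n : ℕ) where
  toMap : C(E3, HSpace L →L[ℝ] E3)
  lipConst : ℝ≥0
  lipschitz : LipschitzWith lipConst toMap
  contDiff : ContDiff ℝ (n + 1 : ℕ) toMap
  apply_eq : ∀ x z, toMap x z = evalH z x
  eq_zero : ∀ x ∉ O, toMap x = 0

namespace SmoothEval

variable {O : Opens E3} {L : DiffOp O} {n : ℕ} (A : SmoothEval L n)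
  {W : Type*} [TopologicalSpace W] [CompactSpace W] {θ : W → VSpace L} {R : ℝ}

include A

omit [CompactSpace W] in
theorem isTrajectory_slice {η : C(W × Icc (0 : ℝ) 1, E3)} {x : E3}
    (h : ∀ p : W × Icc (0 : ℝ) 1,
      η p = x + ∫ r in (0 : ℝ)..p.2, A.toMap (slice η p.1 r) (θ p.1 r)) (w : W) :
    IsTrajectory (θ w) x (slice η w) := by
  refine ⟨(continuous_slice η w).continuousOn, ?_, fun t ht => ?_⟩
  · simp only [← A.apply_eq]
    exact intervalIntegrable_clm_apply_L2 (θ w) (A.toMap.continuous.comp (continuous_slice η w))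
      (by simp) (by simp)
  · have := h (w, ⟨t, ht⟩)
    simp only [← A.apply_eq]
    rw [← this, slice, projIcc_of_mem _ ht]

/-- A single trajectory is the case of a one-point parameter space; its values outside `[0, 1]` are
irrelevant and get replaced by constant extension. -/
theorem IsTrajectory.eqOn_slice {ϑ : VSpace L} {x : E3} {η : ℝ → E3} (h : IsTrajectory ϑ x η) :
    ∃ ξ : C(PUnit.{1} × Icc (0 : ℝ) 1, E3), EqOn η (slice ξ PUnit.unit) (Icc 0 1) ∧
      ∀ p : PUnit.{1} × Icc (0 : ℝ) 1,
        ξ p = x + ∫ r in (0 : ℝ)..p.2, A.toMap (slice ξ p.1 r) (ϑ r) := by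
  let ξ : C(PUnit.{1} × Icc (0 : ℝ) 1, E3) :=
    ⟨fun p => η p.2, (continuousOn_iff_continuous_domRestrict.1 h.1).comp continuous_snd⟩
  have hξ : EqOn η (slice ξ PUnit.unit) (Icc 0 1) := fun t ht => by
    rw [slice, projIcc_of_mem _ ht]
    rfl
  refine ⟨ξ, hξ, fun p => ?_⟩
  refine (h.2.2 p.2 p.2.2).trans ?_
  congr 1
  refine intervalIntegral.integral_congr fun r hr => ?_
  rw [uIcc_of_le p.2.2.1] at hr
  change _ = A.toMap (slice ξ PUnit.unit r) (ϑ r)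
  rw [← hξ ⟨hr.1, hr.2.trans p.2.2.2⟩, A.apply_eq]

theorem eqOn_of_isTrajectory {ϑ : VSpace L} {x : E3} {η ξ : ℝ → E3}
    (hη : IsTrajectory ϑ x η) (hξ : IsTrajectory ϑ x ξ) : EqOn η ξ (Icc 0 1) := by
  obtain ⟨Y, -, hY⟩ := exists_contDiff_solution (W := PUnit.{1}) (θ := fun _ => ϑ)
    (fun _ => le_rfl) (fun _ => continuous_const) A.toMap A.lipschitz A.contDiff
  obtain ⟨η', h1, h2⟩ := IsTrajectory.eqOn_slice A hη
  obtain ⟨ξ', h3, h4⟩ := IsTrajectory.eqOn_slice A hξ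
  have : η' = ξ' := ((hY x η').2 h2).trans ((hY x ξ').2 h4).symm
  intro t ht
  rw [h1 ht, h3 ht, this]

theorem exists_isTrajectory (ϑ : VSpace L) (x : E3) : ∃ η, IsTrajectory ϑ x η := by
  obtain ⟨Y, -, hY⟩ := exists_contDiff_solution (W := PUnit.{1}) (θ := fun _ => ϑ)
    (fun _ => le_rfl) (fun _ => continuous_const) A.toMap A.lipschitz A.contDiff
  exact ⟨_, A.isTrajectory_slice (θ := fun _ => ϑ) ((hY x _).1 rfl) PUnit.unit⟩

theorem isTrajectory_const (ϑ : VSpace L) {x : E3} (hx : x ∉ O) :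
    IsTrajectory ϑ x fun _ => x := by
  have h (z : HSpace L) : evalH z x = 0 := by rw [← A.apply_eq, A.eq_zero x hx]; rfl
  refine ⟨continuousOn_const, ?_, fun t _ => ?_⟩ <;> simp [h]

/-- Uniqueness removes the choice in `flowMap`. Outside `O` the field vanishes, so the constant path
is the trajectory and the extension by the identity agrees with the flow on all of `ℝ³`. -/
theorem flowMap_eq {ϑ : VSpace L} {x : E3} {η : ℝ → E3} (hη : IsTrajectory ϑ x η) :
    flowMap ϑ x = η 1 := by
  have h1 : (1 : ℝ) ∈ Icc (0 : ℝ) 1 := by simp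
  unfold flowMap
  split_ifs with h
  · exact A.eqOn_of_isTrajectory h.2.choose_spec hη h1
  · have hx : x ∉ O := fun hx => h ⟨hx, η, hη⟩
    exact A.eqOn_of_isTrajectory (A.isTrajectory_const ϑ hx) hη h1

/-- The time-one maps of a weakly continuous family depend on `x` in a `C^{n+1}` way, as functions
of the parameter. -/
theorem exists_flowFamily (hR : ∀ w, ‖θ w‖ ≤ R)
    (hθ : ∀ ℓ : VSpace L →L[ℝ] ℝ, Continuous fun w => ℓ (θ w)) :
    ∃ G : E3 → C(W, E3), ContDiff ℝ (n + 1 : ℕ) G ∧ ∀ w x, flowMap (θ w) x = G x w := by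
  obtain ⟨Y, hYs, hY⟩ := exists_contDiff_solution hR hθ A.toMap A.lipschitz A.contDiff
  have h1 : (1 : ℝ) ∈ Icc (0 : ℝ) 1 := by simp
  let ι : C(W, W × Icc (0 : ℝ) 1) := ⟨fun w => (w, ⟨1, h1⟩), by fun_prop⟩
  let res : C(W × Icc (0 : ℝ) 1, E3) →L[ℝ] C(W, E3) :=
    { toFun := fun f => f.comp ι
      map_add' := fun _ _ => rfl
      map_smul' := fun _ _ => rfl
      cont := ContinuousMap.continuous_precomp ι }
  refine ⟨fun x => (Y x).comp ι, res.contDiff.comp hYs, fun w x => ?_⟩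
  rw [A.flowMap_eq (A.isTrajectory_slice ((hY x _).1 rfl) w), slice, projIcc_of_mem _ h1]
  rfl

end SmoothEval

/-! ### Time reversal -/

section TimeReversal

variable {H : Type*} [NormedAddCommGroup H] [NormedSpace ℝ H]

theorem measurePreserving_one_sub : MeasurePreserving (fun r : ℝ => 1 - r)
    (volume.restrict (Icc (0 : ℝ) 1)) (volume.restrict (Icc (0 : ℝ) 1)) := by
  have h := (Measure.measurePreserving_sub_left volume (1 : ℝ)).restrict_preimage
    (measurableSet_Icc (a := (0 : ℝ)) (b := 1))
  simpa using h

/-- The time reversal `ϑ ↦ -ϑ(1 - ·)`. -/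
noncomputable def timeReversal : Lp H 2 (volume.restrict (Icc (0 : ℝ) 1)) →L[ℝ]
    Lp H 2 (volume.restrict (Icc (0 : ℝ) 1)) :=
  -(Lp.compMeasurePreservingₗᵢ ℝ (fun r : ℝ => 1 - r)
    measurePreserving_one_sub).toContinuousLinearMap

theorem coeFn_timeReversal (v : Lp H 2 (volume.restrict (Icc (0 : ℝ) 1))) :
    timeReversal v =ᵐ[volume.restrict (Icc (0 : ℝ) 1)] fun r => -v (1 - r) := by
  have h : timeReversal v = -Lp.compMeasurePreserving (fun r : ℝ => 1 - r)
    measurePreserving_one_sub v := rfl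
  rw [h]
  filter_upwards [Lp.coeFn_neg (Lp.compMeasurePreserving (fun r : ℝ => 1 - r)
    measurePreserving_one_sub v),
    Lp.coeFn_compMeasurePreserving v measurePreserving_one_sub] with r h1 h2
  rw [h1, Pi.neg_apply, h2]
  rfl

theorem norm_timeReversal (v : Lp H 2 (volume.restrict (Icc (0 : ℝ) 1))) :
    ‖timeReversal v‖ = ‖v‖ := by
  change ‖-Lp.compMeasurePreservingₗᵢ ℝ (fun r : ℝ => 1 - r) measurePreserving_one_sub v‖ = _
  rw [norm_neg, LinearIsometry.norm_map]

theorem timeReversal_timeReversal (v : Lp H 2 (volume.restrict (Icc (0 : ℝ) 1))) :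
    timeReversal (timeReversal v) = v := by
  refine Lp.ext ?_
  have h := measurePreserving_one_sub.quasiMeasurePreserving.ae (coeFn_timeReversal v)
  filter_upwards [coeFn_timeReversal (timeReversal v), h] with r h1 h2
  rw [h1, h2]
  simp

end TimeReversal

namespace SmoothEval

variable {O : Opens E3} {L : DiffOp O} {n : ℕ} (A : SmoothEval L n)
  {W : Type*} [TopologicalSpace W] [CompactSpace W] {θ : W → VSpace L} {R : ℝ}

include A

theorem isTrajectory_timeReversal {ϑ : VSpace L} {x : E3} {η : ℝ → E3}
    (h : IsTrajectory ϑ x η) :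
    IsTrajectory (timeReversal ϑ) (η 1) fun t => η (1 - t) := by
  -- The reversed control is known only almost everywhere in time; moving the sign out uses
  -- linearity of the evaluation, which `A` supplies.
  have hev : ∀ᵐ r ∂(volume.restrict (Icc (0 : ℝ) 1)),
      evalH (timeReversal ϑ r) (η (1 - r)) = -evalH (ϑ (1 - r)) (η (1 - r)) := by
    filter_upwards [coeFn_timeReversal ϑ] with r hr
    rw [hr, ← A.apply_eq, map_neg, A.apply_eq]
  have hint : IntervalIntegrable (fun r => evalH (ϑ (1 - r)) (η (1 - r))) volume 0 1 := by
    have := (h.2.1.comp_sub_left 1).symm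
    simpa using this
  have hev' : ∀ t ∈ Icc (0 : ℝ) 1, ∀ᵐ r ∂(volume.restrict (uIoc (0 : ℝ) t)),
      evalH (timeReversal ϑ r) (η (1 - r)) = -evalH (ϑ (1 - r)) (η (1 - r)) := by
    intro t ht
    refine ae_restrict_of_ae_restrict_of_subset ?_ hev
    rw [uIoc_of_le ht.1]
    exact fun r hr => ⟨hr.1.le, hr.2.trans ht.2⟩
  refine ⟨h.1.comp (by fun_prop) fun t ht => ⟨by linarith [ht.2], by linarith [ht.1]⟩, ?_, ?_⟩
  · refine hint.neg.congr_ae ?_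
    filter_upwards [hev' 1 (by simp)] with r hr
    rw [hr]
    rfl
  · intro t ht
    change η (1 - t) = _
    rw [intervalIntegral.integral_congr_ae_restrict (hev' t ht), intervalIntegral.integral_neg,
      intervalIntegral.integral_comp_sub_left (fun s => evalH (ϑ s) (η s)) 1, sub_zero,
      h.2.2 1 (by simp), h.2.2 (1 - t) ⟨by linarith [ht.2], by linarith [ht.1]⟩,
      ← intervalIntegral.integral_add_adjacent_intervals (a := 0) (b := 1 - t) (c := 1)]
    · abel
    · exact h.2.1.mono_set (by
        rw [uIcc_of_le (by linarith [ht.2]), uIcc_of_le zero_le_one]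
        exact Icc_subset_Icc_right (by linarith [ht.1]))
    · exact h.2.1.mono_set (by
        rw [uIcc_of_le (by linarith [ht.1]), uIcc_of_le zero_le_one]
        exact Icc_subset_Icc_left (by linarith [ht.2]))

theorem flowMap_timeReversal_flowMap (ϑ : VSpace L) (x : E3) :
    flowMap (timeReversal ϑ) (flowMap ϑ x) = x := by
  obtain ⟨η, hη⟩ := A.exists_isTrajectory ϑ x
  rw [A.flowMap_eq hη, A.flowMap_eq (A.isTrajectory_timeReversal hη), sub_self,
    hη.2.2 0 (by simp)]
  simp

theorem flowMap_flowMap_timeReversal (ϑ : VSpace L) (x : E3) :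
    flowMap ϑ (flowMap (timeReversal ϑ) x) = x := by
  have := A.flowMap_timeReversal_flowMap (timeReversal ϑ) x
  rwa [timeReversal_timeReversal] at this

/-- If the image left `O`, the reversed flow would fix it, forcing it to equal `x`. -/
theorem flowMap_mem (ϑ : VSpace L) {x : E3} (hx : x ∈ O) : flowMap ϑ x ∈ O := by
  by_contra h
  have h1 := A.flowMap_timeReversal_flowMap ϑ x
  rw [flowMap, dif_neg (fun h' => h h'.1)] at h1
  exact h (h1.symm ▸ hx)

theorem contDiff_flowMap (ϑ : VSpace L) : ContDiff ℝ (n + 1 : ℕ) (flowMap ϑ) := by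
  obtain ⟨G, hG, h⟩ := A.exists_flowFamily (W := PUnit.{1}) (θ := fun _ => ϑ)
    (fun _ => le_rfl) (fun _ => continuous_const)
  have : flowMap ϑ = fun x => ContinuousMap.evalCLM ℝ PUnit.unit (G x) :=
    funext fun x => h PUnit.unit x
  rw [this]
  exact (ContinuousMap.evalCLM ℝ PUnit.unit).contDiff.comp hG

/-- The time-one map of the flow, as an element of the diffeomorphism group. -/
noncomputable def flowDiffeo (ϑ : VSpace L) : DiffeoGroup n where
  toFun := flowMap ϑ
  invFun := flowMap (timeReversal ϑ)
  left_inv := A.flowMap_timeReversal_flowMap ϑ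
  right_inv := A.flowMap_flowMap_timeReversal ϑ
  contMDiff_toFun := ((A.contDiff_flowMap ϑ).of_le (by exact_mod_cast n.le_succ)).contMDiff
  contMDiff_invFun := ((A.contDiff_flowMap _).of_le (by exact_mod_cast n.le_succ)).contMDiff

end SmoothEval

/-! ### Continuity in the topology of the diffeomorphism group -/

section Continuity

variable {W : Type*} [TopologicalSpace W] [CompactSpace W]

/-- Evaluation at `w` is bounded and linear, so it commutes with differentiation in `x`. Smoothness
with values in `C(W, E3)` thus encodes continuity of the derivatives in `w`. -/
theorem exists_partialD_family {j : ℕ} {G : E3 → C(W, E3)} (hG : ContDiff ℝ (j + 1 : ℕ) G)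
    (i : Fin 3) : ∃ G' : E3 → C(W, E3), ContDiff ℝ j G' ∧
      ∀ w, partialD i (fun x => G x w) = fun x => G' x w := by
  refine ⟨fun x => fderiv ℝ G x (EuclideanSpace.single i 1),
    (hG.fderiv_right (by exact_mod_cast le_rfl)).clm_apply contDiff_const, fun w => ?_⟩
  funext x
  have h := (ContinuousMap.evalCLM ℝ w : C(W, E3) →L[ℝ] E3).hasFDerivAt.comp x
    (hG.differentiable (by simp) x).hasFDerivAt
  exact congrArg (fun f => f (EuclideanSpace.single i 1)) h.fderiv

theorem exists_iterate_partialD_family {j : ℕ} (a : ℕ) {G : E3 → C(W, E3)}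
    (hG : ContDiff ℝ (j + a : ℕ) G) (i : Fin 3) : ∃ G' : E3 → C(W, E3), ContDiff ℝ j G' ∧
      ∀ w, (partialD i)^[a] (fun x => G x w) = fun x => G' x w := by
  induction a generalizing G with
  | zero => exact ⟨G, hG, fun _ => rfl⟩
  | succ a ih =>
    obtain ⟨G₁, hG₁, h₁⟩ := exists_partialD_family (j := j + a) hG i
    obtain ⟨G₂, hG₂, h₂⟩ := ih hG₁
    exact ⟨G₂, hG₂, fun w => by rw [Function.iterate_succ_apply, h₁, h₂]⟩

theorem exists_multiD_family {n : ℕ} {G : E3 → C(W, E3)} (hG : ContDiff ℝ n G)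
    {α : Fin 3 → ℕ} (hα : α ∈ multiIdx n) : ∃ G' : E3 → C(W, E3), Continuous G' ∧
      ∀ w, multiD α (fun x => G x w) = fun x => G' x w := by
  have hα' : α 0 + α 1 + α 2 ≤ n := by
    simpa [Fin.sum_univ_three] using mem_multiIdx.1 hα
  obtain ⟨G₂, hG₂, h₂⟩ := exists_iterate_partialD_family (j := α 0 + α 1) (α 2)
    (hG.of_le (by exact_mod_cast hα')) 2
  obtain ⟨G₁, hG₁, h₁⟩ := exists_iterate_partialD_family (j := α 0) (α 1) hG₂ 1
  obtain ⟨G₀, hG₀, h₀⟩ := exists_iterate_partialD_family (j := 0) (α 0) (by simpa using hG₁) 0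
  exact ⟨G₀, hG₀.continuous, fun w => by rw [multiD, h₂, h₁, h₀]⟩

/-- Exchanging variables gives a continuous map from `W` to `C(E3, E3)`, whose topology is that of
uniform convergence on compact sets. The series over balls passes to the limit by domination with a
geometric series. -/
theorem tendsto_rho [T2Space W] {G : E3 → C(W, E3)} (hG : Continuous G) (w₀ : W) :
    Tendsto (fun w => rho (fun x => G x w) fun x => G x w₀) (𝓝 w₀) (𝓝 0) := by
  let Φ : C(W, C(E3, E3)) := ContinuousMap.curry
    ((ContinuousMap.uncurry ⟨G, hG⟩).comp ⟨Prod.swap, continuous_swap⟩)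
  have hs (N : ℕ) : Tendsto (fun w => supBall N (fun x => G x w) fun x => G x w₀)
      (𝓝 w₀) (𝓝 0) := by
    have h := ContinuousMap.tendsto_iff_forall_isCompact_tendstoUniformlyOn.1
      (Φ.continuous.tendsto w₀) _ (isCompact_closedBall (0 : E3) (N : ℝ))
    rw [Metric.tendsto_nhds]
    intro ε hε
    filter_upwards [Metric.tendstoUniformlyOn_iff.1 h (ε / 2) (half_pos hε)] with w hw
    rw [Real.dist_0_eq_abs, abs_of_nonneg (supBall_nonneg _ _ _)]
    refine lt_of_le_of_lt (Real.iSup_le (fun x => ?_) (half_pos hε).le) (half_lt_self hε)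
    rw [norm_sub_rev]
    exact (dist_eq_norm _ _).symm.trans_le (hw x x.2).le
  have h := tendsto_tsum_of_dominated_convergence (𝓕 := 𝓝 w₀)
    (f := fun w (N : ℕ) => (1 / 2 : ℝ) ^ (N + 1) *
      (supBall (N + 1) (fun x => G x w) (fun x => G x w₀) /
        (1 + supBall (N + 1) (fun x => G x w) (fun x => G x w₀))))
    (g := fun _ => 0) (bound := fun N => (1 / 2 : ℝ) ^ (N + 1))
    ((summable_nat_add_iff 1).2 summable_geometric_two) (fun N => ?_)
    (Eventually.of_forall fun w N => ?_)
  · rwa [tsum_zero] at h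
  · have h1 := ((hs (N + 1)).div ((hs (N + 1)).const_add 1) (by norm_num)).const_mul
      ((1 / 2 : ℝ) ^ (N + 1))
    simpa using h1
  · rw [Real.norm_of_nonneg (rho_term_nonneg _ _ _)]
    have h0 := supBall_nonneg (N + 1) (fun x => G x w) fun x => G x w₀
    exact mul_le_of_le_one_right (by positivity) ((div_le_one (by positivity)).2 (by linarith))

theorem tendsto_lamDist [T2Space W] {n : ℕ} {G : E3 → C(W, E3)} (hG : ContDiff ℝ n G) (w₀ : W) :
    Tendsto (fun w => lamDist n (fun x => G x w) fun x => G x w₀) (𝓝 w₀) (𝓝 0) := by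
  unfold lamDist
  rw [← Finset.sum_const_zero (s := multiIdx n)]
  refine tendsto_finsetSum _ fun α hα => ?_
  obtain ⟨G', hG', h⟩ := exists_multiD_family hG hα
  simp only [h]
  exact tendsto_rho hG' w₀

end Continuity

/-- Time reversal is linear and isometric, so the reversed family is again bounded and weakly
continuous; both halves of the metric are then treated alike. -/
theorem SmoothEval.continuous_flowDiffeo {O : Opens E3} {L : DiffOp O} {n : ℕ}
    (A : SmoothEval L n) {W : Type*} [TopologicalSpace W] [CompactSpace W] [T2Space W]
    {θ : W → VSpace L} {R : ℝ} (hR : ∀ w, ‖θ w‖ ≤ R)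
    (hθ : ∀ ℓ : VSpace L →L[ℝ] ℝ, Continuous fun w => ℓ (θ w)) :
    Continuous fun w => A.flowDiffeo (θ w) := by
  obtain ⟨G, hG, hGe⟩ := A.exists_flowFamily hR hθ
  obtain ⟨G', hG', hGe'⟩ := A.exists_flowFamily (θ := fun w => timeReversal (θ w)) (R := R)
    (fun w => (norm_timeReversal _).trans_le (hR w)) (fun ℓ => hθ (ℓ.comp timeReversal))
  refine continuous_iff_continuousAt.2 fun w₀ => ?_
  refine tendsto_iff_dist_tendsto_zero.2 ?_
  have h1 := tendsto_lamDist (n := n) (hG.of_le (by exact_mod_cast n.le_succ)) w₀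
  have h2 := tendsto_lamDist (n := n) (hG'.of_le (by exact_mod_cast n.le_succ)) w₀
  have h := h1.add h2
  rw [add_zero] at h
  refine h.congr fun w => ?_
  have e (w) : (A.flowDiffeo (θ w) : E3 → E3) = fun x => G x w := funext fun x => hGe w x
  have e' (w) : (A.flowDiffeo (θ w)).inv = fun x => G' x w := funext fun x => hGe' w x
  change _ = lamDist n (A.flowDiffeo (θ w)) (A.flowDiffeo (θ w₀)) +
    lamDist n (A.flowDiffeo (θ w)).inv (A.flowDiffeo (θ w₀)).inv
  rw [e, e, e', e']

end ImageMatching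

/-! ### Partial derivatives of test functions -/

namespace ImageMatching

open Filter Topology

theorem partialD_comm {f : E3 → E3} (hf : ContDiff ℝ ∞ f) (i j : Fin 3) :
    partialD i (partialD j f) = partialD j (partialD i f) := by
  funext x
  have hd : ∀ y, HasFDerivAt f (fderiv ℝ f y) y := fun y =>
    (hf.differentiable (by simp) y).hasFDerivAt
  have hd2 : HasFDerivAt (fderiv ℝ f) (fderiv ℝ (fderiv ℝ f) x) x :=
    ((hf.fderiv_right (m := 1) (by norm_cast)).differentiable (by simp) x).hasFDerivAt
  have h (k : Fin 3) : HasFDerivAt (partialD k f)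
      ((ContinuousLinearMap.apply ℝ E3 (EuclideanSpace.single k (1 : ℝ))).comp
        (fderiv ℝ (fderiv ℝ f) x)) x :=
    (ContinuousLinearMap.apply ℝ E3 (EuclideanSpace.single k (1 : ℝ))).hasFDerivAt.comp x hd2
  unfold partialD at h ⊢
  rw [(h j).fderiv, (h i).fderiv]
  exact second_derivative_symmetric hd hd2 _ _

theorem partialD_iterate_comm {f : E3 → E3} (hf : ContDiff ℝ ∞ f) (i j : Fin 3) (a : ℕ) :
    partialD i ((partialD j)^[a] f) = (partialD j)^[a] (partialD i f) := by
  induction a generalizing f with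
  | zero => rfl
  | succ a ih =>
    rw [Function.iterate_succ_apply, Function.iterate_succ_apply,
      ih (contDiff_partialD_infty hf j), partialD_comm hf]

theorem contDiff_multiD_infty {f : E3 → E3} (hf : ContDiff ℝ ∞ f) (α : Fin 3 → ℕ) :
    ContDiff ℝ ∞ (multiD α f) :=
  contDiff_iterate_partialD_infty (contDiff_iterate_partialD_infty
    (contDiff_iterate_partialD_infty hf 2 _) 1 _) 0 _

/-- Since `multiD` fixes an order of differentiation, symmetry of second derivatives is needed to
move the new derivative to its place. -/
theorem partialD_multiD {f : E3 → E3} (hf : ContDiff ℝ ∞ f) (i : Fin 3) (α : Fin 3 → ℕ) :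
    partialD i (multiD α f) = multiD (α + Pi.single i 1) f := by
  have h2 := contDiff_iterate_partialD_infty hf 2 (α 2)
  have h1 := contDiff_iterate_partialD_infty h2 1 (α 1)
  unfold multiD
  fin_cases i
  · simp [← Function.iterate_succ_apply' (partialD 0)]
  · simp [partialD_iterate_comm h1, ← Function.iterate_succ_apply' (partialD 1)]
  · simp [partialD_iterate_comm h1, partialD_iterate_comm h2,
      ← Function.iterate_succ_apply' (partialD 2)]

theorem sum_add_single (α : Fin 3 → ℕ) (i : Fin 3) :
    ∑ j, (α + Pi.single i 1 : Fin 3 → ℕ) j = ∑ j, α j + 1 := by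
  simp [Finset.sum_add_distrib]

theorem tsupport_partialD_subset (f : E3 → E3) (i : Fin 3) :
    tsupport (partialD i f) ⊆ tsupport f := by
  refine closure_minimal (fun x hx => ?_) (isClosed_tsupport f)
  refine support_fderiv_subset ℝ (f := f) ?_
  intro h
  exact hx (by simp [partialD, h])

theorem tsupport_multiD_subset (f : E3 → E3) (α : Fin 3 → ℕ) :
    tsupport (multiD α f) ⊆ tsupport f := by
  have h (i : Fin 3) (a : ℕ) (g : E3 → E3) : tsupport ((partialD i)^[a] g) ⊆ tsupport g := by
    induction a generalizing g with
    | zero => exact Subset.rfl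
    | succ a ih => exact (ih _).trans (tsupport_partialD_subset g i)
  exact (h _ _ _).trans ((h _ _ _).trans (h _ _ _))

/-! ### A Sobolev inequality -/

/-- Fundamental theorem of calculus along the line in direction `i`, using compact support. The form
as a marginal integral lets the three directions be iterated. -/
theorem enorm_le_lmarginal_partialD {g : E3 → E3} (hg : ContDiff ℝ ∞ g)
    (hc : HasCompactSupport g) (i : Fin 3) :
    (fun x : Fin 3 → ℝ => ‖g (WithLp.toLp 2 x)‖ₑ) ≤
      ∫⋯∫⁻_{i}, (fun x : Fin 3 → ℝ => ‖partialD i g (WithLp.toLp 2 x)‖ₑ)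
        ∂(fun _ => (volume : Measure ℝ)) := by
  intro x
  let e := (PiLp.continuousLinearEquiv 2 ℝ (fun _ : Fin 3 => ℝ)).symm
  let γ : ℝ → E3 := fun s => e (Function.update x i s)
  have hγ : ∀ s, HasDerivAt γ (EuclideanSpace.single i 1) s := fun s =>
    (e : (Fin 3 → ℝ) →L[ℝ] E3).hasFDerivAt.comp_hasDerivAt s (hasDerivAt_update x i s)
  have hγs : ContDiff ℝ 1 γ := e.contDiff.comp (contDiff_update 1 x i)
  have hγe : IsClosedEmbedding γ :=
    e.toHomeomorph.isClosedEmbedding.comp (isClosedEmbedding_update x i)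
  have h := HasCompactSupport.enorm_le_lintegral_Ici_deriv
    ((hg.of_le (by norm_cast)).comp hγs) (hc.comp_isClosedEmbedding hγe) (x i)
  have hx : γ (x i) = WithLp.toLp 2 x := by simp [γ, e]
  have hd : ∀ s, deriv (g ∘ γ) s = partialD i g (WithLp.toLp 2 (Function.update x i s)) :=
    fun s => ((hg.differentiable (by simp) (γ s)).hasFDerivAt.comp_hasDerivAt s (hγ s)).deriv
  rw [lmarginal_singleton]
  simp only [Function.comp_apply, hx] at h
  refine h.trans ((lintegral_mono_set (subset_univ _)).trans ?_)
  rw [Measure.restrict_univ]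
  exact lintegral_mono fun s => by rw [← hd]

theorem enorm_le_lintegral_partialD {g : E3 → E3} (hg : ContDiff ℝ ∞ g)
    (hc : HasCompactSupport g) (x : E3) :
    ‖g x‖ₑ ≤ ∫⁻ y, ‖partialD 0 (partialD 1 (partialD 2 g)) y‖ₑ := by
  have hm {u : E3 → E3} (hu : ContDiff ℝ ∞ u) :
      Measurable fun y : Fin 3 → ℝ => ‖u (WithLp.toLp 2 y)‖ₑ :=
    (hu.continuous.comp (PiLp.continuous_toLp 2 _)).enorm.measurable
  have h2 := contDiff_partialD_infty hg 2
  have h1 := contDiff_partialD_infty h2 1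
  have h0 := contDiff_partialD_infty h1 0
  have hc2 : HasCompactSupport (partialD 2 g) :=
    hc.of_isClosed_subset (isClosed_tsupport _) (tsupport_partialD_subset g 2)
  have hc1 : HasCompactSupport (partialD 1 (partialD 2 g)) :=
    hc2.of_isClosed_subset (isClosed_tsupport _) (tsupport_partialD_subset _ 1)
  have h := (enorm_le_lmarginal_partialD hg hc 2).trans (lmarginal_mono
    ((enorm_le_lmarginal_partialD h2 hc2 1).trans (lmarginal_mono
      (enorm_le_lmarginal_partialD h1 hc1 0))))
  rw [← lmarginal_union _ _ (hm h0) (by decide), ← lmarginal_union _ _ (hm h0) (by decide),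
    show ({2} ∪ ({1} ∪ {0}) : Finset (Fin 3)) = Finset.univ by decide, lmarginal_univ] at h
  refine (h x.ofLp).trans_eq ?_
  exact (PiLp.volume_preserving_toLp (Fin 3)).lintegral_comp_emb
    (MeasurableEquiv.toLp 2 (Fin 3 → ℝ)).measurableEmbedding
    (fun y => ‖partialD 0 (partialD 1 (partialD 2 g)) y‖ₑ)

/-- The sup norm is bounded by the `L¹` norm of one mixed derivative of three orders higher; on the
bounded set `O`, Cauchy–Schwarz converts `L¹` into `L²` at the cost of the square root of the
volume. -/
theorem norm_multiD_le_sobolevNorm {O : Opens E3} (hO : Bornology.IsBounded (O : Set E3))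
    (f : 𝓓(O, E3)) {N : ℕ} {α : Fin 3 → ℕ} (hα : ∑ i, α i + 3 ≤ N) (x : E3) :
    ‖multiD α f x‖ ≤ Real.sqrt (volume.real (O : Set E3)) * sobolevNorm N f := by
  have hf : ContDiff ℝ ∞ f := f.contDiff
  have hsub (β : Fin 3 → ℕ) : tsupport (multiD β f) ⊆ O :=
    (tsupport_multiD_subset f β).trans f.tsupport_subset
  have hcs (β : Fin 3 → ℕ) : HasCompactSupport (multiD β f) :=
    f.hasCompactSupport.of_isClosed_subset (isClosed_tsupport _) (tsupport_multiD_subset f β)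
  have hcont (β : Fin 3 → ℕ) : Continuous (multiD β f) := (contDiff_multiD_infty hf β).continuous
  have hfin : volume (O : Set E3) < ⊤ := hO.measure_lt_top
  have : IsFiniteMeasure (volume.restrict (O : Set E3)) := ⟨by simpa using hfin⟩
  set β : Fin 3 → ℕ := α + Pi.single 2 1 + Pi.single 1 1 + Pi.single 0 1 with hβ
  have hβN : β ∈ multiIdx N := by
    rw [mem_multiIdx, hβ, sum_add_single, sum_add_single, sum_add_single]
    omega
  have h1 := enorm_le_lintegral_partialD (contDiff_multiD_infty hf α) (hcs α) x
  rw [partialD_multiD hf, partialD_multiD hf, partialD_multiD hf, ← hβ,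
    ← setLIntegral_eq_of_support_subset (s := (O : Set E3)) (fun y hy => hsub β
      (subset_tsupport _ (by simpa using hy))), ← eLpNorm_one_eq_lintegral_enorm] at h1
  have h2 := eLpNorm_le_eLpNorm_mul_rpow_measure_univ (μ := volume.restrict (O : Set E3))
    (p := 1) (q := 2) (by norm_num) (hcont β).aestronglyMeasurable
  have hL2 : MemLp (multiD β f) 2 (volume.restrict (O : Set E3)) :=
    ((hcont β).memLp_of_hasCompactSupport (hcs β)).restrict _
  rw [hL2.eLpNorm_eq_integral_rpow_norm (by norm_num) (by norm_num),
    Measure.restrict_apply_univ] at h2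
  have h3 := (ENNReal.toReal_le_toReal enorm_ne_top
    (ENNReal.mul_ne_top ENNReal.ofReal_ne_top (ENNReal.rpow_ne_top_of_nonneg (by norm_num) hfin.ne))).2 (h1.trans h2)
  rw [toReal_enorm, ENNReal.toReal_mul, ENNReal.toReal_ofReal (by positivity),
    ← ENNReal.toReal_rpow, mul_comm] at h3
  norm_num at h3
  rw [← Real.sqrt_eq_rpow, ← Real.sqrt_eq_rpow] at h3
  refine h3.trans (mul_le_mul_of_nonneg_left (Real.sqrt_le_sqrt ?_) (Real.sqrt_nonneg _))
  have hint (γ : Fin 3 → ℕ) : Integrable (fun u => ‖multiD γ f u‖ ^ 2)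
      (volume.restrict (O : Set E3)) :=
    (((hcont γ).memLp_of_hasCompactSupport (hcs γ)).restrict _ : MemLp (multiD γ f) 2
      (volume.restrict (O : Set E3))).integrable_norm_pow (by norm_num)
  refine integral_mono (hint β) (integrable_finsetSum _ fun γ _ => hint γ) fun u => ?_
  exact Finset.single_le_sum (f := fun γ => ‖multiD γ f u‖ ^ 2) (fun _ _ => by positivity) hβN

end ImageMatching

/-! ### Smoothness of the evaluation functionals -/

namespace ImageMatching

open Filter Topology

theorem fderiv_apply_eq_sum (f : E3 → E3) (x v : E3) :
    fderiv ℝ f x v = ∑ i, v i • partialD i f x := by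
  conv_lhs => rw [← (EuclideanSpace.basisFun (Fin 3) ℝ).sum_repr v]
  simp [partialD]

theorem abs_apply_le_norm (v : E3) (i : Fin 3) : |v i| ≤ ‖v‖ := PiLp.norm_apply_le v i

theorem norm_sub_le_of_partialD_le {f : E3 → E3} (hf : ContDiff ℝ ∞ f) {c : ℝ}
    (hc : ∀ i x, ‖partialD i f x‖ ≤ c) (x y : E3) : ‖f y - f x‖ ≤ 3 * c * ‖y - x‖ := by
  have hc0 : 0 ≤ c := (norm_nonneg _).trans (hc 0 0)
  refine convex_univ.norm_image_sub_le_of_norm_fderiv_le (𝕜 := ℝ)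
    (fun z _ => hf.differentiable (by simp) z) (fun z _ => ?_) (mem_univ _) (mem_univ _)
  refine ContinuousLinearMap.opNorm_le_bound _ (by positivity) fun v => ?_
  rw [fderiv_apply_eq_sum]
  calc ‖∑ i, v i • partialD i f z‖ ≤ ∑ i : Fin 3, ‖v‖ * c := by
        refine norm_sum_le_of_le _ fun i _ => ?_
        rw [norm_smul]
        exact mul_le_mul (abs_apply_le_norm v i) (hc i z) (norm_nonneg _) (norm_nonneg _)
    _ = 3 * c * ‖v‖ := by simp; ring

theorem norm_sub_sub_sum_le {f : E3 → E3} (hf : ContDiff ℝ ∞ f) {c : ℝ}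
    (hc : ∀ i j x, ‖partialD j (partialD i f) x‖ ≤ c) (x y : E3) :
    ‖f y - f x - ∑ i, (y - x) i • partialD i f x‖ ≤ 9 * c * ‖y - x‖ * ‖y - x‖ := by
  have hc0 : 0 ≤ c := (norm_nonneg _).trans (hc 0 0 0)
  rw [← fderiv_apply_eq_sum]
  refine (convex_closedBall x ‖y - x‖).norm_image_sub_le_of_norm_hasFDerivWithin_le'
    (f' := fderiv ℝ f) (fun z _ => (hf.differentiable (by simp) z).hasFDerivAt.hasFDerivWithinAt)
    (fun z hz => ?_) (by simp) (by simp [dist_eq_norm])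
  refine ContinuousLinearMap.opNorm_le_bound _ (by positivity) fun v => ?_
  rw [sub_apply, fderiv_apply_eq_sum, fderiv_apply_eq_sum, ← Finset.sum_sub_distrib]
  have hz' : ‖z - x‖ ≤ ‖y - x‖ := by simpa [dist_eq_norm] using hz
  calc ‖∑ i, (v i • partialD i f z - v i • partialD i f x)‖
      ≤ ∑ i : Fin 3, ‖v‖ * (3 * c * ‖y - x‖) := by
        refine norm_sum_le_of_le _ fun i _ => ?_
        rw [← smul_sub, norm_smul]
        refine mul_le_mul (abs_apply_le_norm v i) ?_ (norm_nonneg _) (norm_nonneg _)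
        exact (norm_sub_le_of_partialD_le (contDiff_partialD_infty hf i) (hc i) x z).trans
          (mul_le_mul_of_nonneg_left hz' (by positivity))
    _ = 9 * c * ‖y - x‖ * ‖v‖ := by simp; ring

/-- A family indexed by multi-indices which satisfies Taylor expansions of first order, as partial
derivatives of a smooth function do, consists of smooth functions. -/
theorem contDiff_of_taylor {F : Type*} [NormedAddCommGroup F] [NormedSpace ℝ F]
    {D : (Fin 3 → ℕ) → E3 → F} {N : ℕ} {c : ℝ} (hc : 0 ≤ c)
    (hL : ∀ α, ∑ i, α i + 1 ≤ N → ∀ x y, ‖D α y - D α x‖ ≤ c * ‖y - x‖)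
    (hT : ∀ α, ∑ i, α i + 2 ≤ N → ∀ x y,
      ‖D α y - D α x - ∑ i, (y - x) i • D (α + Pi.single i 1) x‖ ≤ c * ‖y - x‖ * ‖y - x‖)
    (j : ℕ) {α : Fin 3 → ℕ} (hα : ∑ i, α i + j + 1 ≤ N) : ContDiff ℝ j (D α) := by
  induction j generalizing α with
  | zero =>
    refine contDiff_zero.2 (LipschitzWith.of_dist_le_mul (K := c.toNNReal) fun y x => ?_).continuous
    rw [dist_eq_norm, dist_eq_norm, Real.coe_toNNReal _ hc]
    exact hL α hα x y
  | succ j ih =>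
    refine contDiff_succ_iff_hasFDerivAt.2 ⟨fun x => ∑ i : Fin 3,
      ContinuousLinearMap.smulRightL ℝ E3 F (EuclideanSpace.proj i) (D (α + Pi.single i 1) x),
      ContDiff.sum fun i _ => (ContinuousLinearMap.smulRightL ℝ E3 F
        (EuclideanSpace.proj i)).contDiff.comp (ih (by rw [sum_add_single]; omega)), fun x => ?_⟩
    rw [hasFDerivAt_iff_isLittleO, Asymptotics.isLittleO_iff]
    intro ε hε
    -- The denominator `c + 1` covers the case `c = 0`.
    have hδ : 0 < ε / (c + 1) := by positivity
    filter_upwards [Metric.ball_mem_nhds x hδ] with y hy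
    have hy' : (c + 1) * ‖y - x‖ ≤ ε := by
      rw [mul_comm, ← le_div_iff₀ (by positivity), ← dist_eq_norm]
      exact (Metric.mem_ball.1 hy).le
    have h := hT α (by omega) x y
    simp only [sum_apply, ContinuousLinearMap.smulRightL_apply_apply,
      ContinuousLinearMap.smulRight_apply, PiLp.proj_apply]
    refine h.trans (mul_le_mul_of_nonneg_right ?_ (norm_nonneg _))
    nlinarith [norm_nonneg (y - x)]

section Evaluation

variable {O : Opens E3} {L : DiffOp O}

theorem contDiff_preH (f : PreH L) : ContDiff ℝ ∞ (show 𝓓(O, E3) from f) :=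
  TestFunction.contDiff (show 𝓓(O, E3) from f)

/-- The functional `f ↦ ∂^α f(x)` as a linear map on test functions. -/
noncomputable def multiDEval (L : DiffOp O) (α : Fin 3 → ℕ) (x : E3) : PreH L →ₗ[ℝ] E3 where
  toFun f := multiD α (show 𝓓(O, E3) from f) x
  map_add' f g := congrFun (multiD_add (contDiff_preH f) (contDiff_preH g) α) x
  map_smul' c f := congrFun (multiD_smul (contDiff_preH f) c α) x

/-- All partial derivatives of order at most `N` of test functions are dominated by the norm
of `H`. -/
def DominatesDerivatives (L : DiffOp O) (N : ℕ) (C : ℝ) : Prop :=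
  ∀ α : Fin 3 → ℕ, ∑ i, α i ≤ N → ∀ x f, ‖multiDEval L α x f‖ ≤ C * ‖f‖

variable {N : ℕ} {C : ℝ}

/-- The functional `f ↦ ∂^α f(x)` as a bounded operator on `H` (for orders at most `N`). -/
noncomputable def multiDEvalCLM (hC : DominatesDerivatives L N C) (α : Fin 3 → ℕ) (x : E3) :
    HSpace L →L[ℝ] E3 :=
  if hα : ∑ i, α i ≤ N then ((multiDEval L α x).mkContinuous C (hC α hα x)).extend
    (UniformSpace.Completion.toComplL (𝕜 := ℝ) (E := PreH L)) else 0

theorem multiDEvalCLM_coe (hC : DominatesDerivatives L N C) {α : Fin 3 → ℕ}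
    (hα : ∑ i, α i ≤ N) (x : E3) (f : PreH L) :
    multiDEvalCLM hC α x f = multiD α (show 𝓓(O, E3) from f) x := by
  rw [multiDEvalCLM, dif_pos hα]
  exact ((multiDEval L α x).mkContinuous C (hC α hα x)).extend_eq
    (e := UniformSpace.Completion.toComplL (𝕜 := ℝ) (E := PreH L))
    UniformSpace.Completion.denseRange_coe
    (UniformSpace.Completion.isUniformInducing_coe _) f

theorem opNorm_le_of_preH {T : HSpace L →L[ℝ] E3} {c : ℝ} (hc : 0 ≤ c)
    (h : ∀ f : PreH L, ‖T f‖ ≤ c * ‖f‖) : ‖T‖ ≤ c := by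
  refine T.opNorm_le_bound hc fun z => ?_
  refine UniformSpace.Completion.induction_on z ?_ fun f => ?_
  · exact isClosed_le T.continuous.norm (continuous_const.mul continuous_norm)
  · rw [UniformSpace.Completion.norm_coe]
    exact h f

theorem norm_partialD_multiD_le (hC : DominatesDerivatives L N C) {α : Fin 3 → ℕ}
    (hα : ∑ i, α i + 1 ≤ N) (f : PreH L) (i : Fin 3) (x : E3) :
    ‖partialD i (multiD α (show 𝓓(O, E3) from f)) x‖ ≤ C * ‖f‖ := by
  rw [partialD_multiD (contDiff_preH f)]
  exact hC _ (by rwa [sum_add_single]) x f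

/-- The mean value inequality on a test function is linear in `‖f‖`, so by density it becomes an
operator norm bound. It gives `3 C`; the weaker `9 C` matches the constant of the second-order
Taylor estimate. -/
theorem norm_multiDEvalCLM_sub_le (hC : DominatesDerivatives L N C) (hC0 : 0 ≤ C)
    {α : Fin 3 → ℕ} (hα : ∑ i, α i + 1 ≤ N) (x y : E3) :
    ‖multiDEvalCLM hC α y - multiDEvalCLM hC α x‖ ≤ 9 * C * ‖y - x‖ := by
  refine opNorm_le_of_preH (by positivity) fun f => ?_
  rw [sub_apply, multiDEvalCLM_coe hC (by omega), multiDEvalCLM_coe hC (by omega)]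
  have h := norm_sub_le_of_partialD_le (contDiff_multiD_infty (contDiff_preH f) α)
    (norm_partialD_multiD_le hC hα f) x y
  have h0 : 0 ≤ C * ‖f‖ * ‖y - x‖ := by positivity
  linarith

theorem norm_multiDEvalCLM_taylor_le (hC : DominatesDerivatives L N C) (hC0 : 0 ≤ C)
    {α : Fin 3 → ℕ} (hα : ∑ i, α i + 2 ≤ N) (x y : E3) :
    ‖multiDEvalCLM hC α y - multiDEvalCLM hC α x -
      ∑ i, (y - x) i • multiDEvalCLM hC (α + Pi.single i 1) x‖ ≤
        9 * C * ‖y - x‖ * ‖y - x‖ := by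
  refine opNorm_le_of_preH (by positivity) fun f => ?_
  have h := norm_sub_sub_sum_le (contDiff_multiD_infty (contDiff_preH f) α) (c := C * ‖f‖)
    (fun i j z => by
      rw [partialD_multiD (contDiff_preH f)]
      exact norm_partialD_multiD_le hC (by rw [sum_add_single]; omega) f j z) x y
  have e (i : Fin 3) : multiDEvalCLM hC (α + Pi.single i 1) x f =
      partialD i (multiD α (show 𝓓(O, E3) from f)) x := by
    rw [multiDEvalCLM_coe hC (by rw [sum_add_single]; omega), partialD_multiD (contDiff_preH f)]
  simp only [sub_apply, sum_apply, smul_apply, e]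
  rw [multiDEvalCLM_coe hC (by omega), multiDEvalCLM_coe hC (by omega)]
  exact h.trans_eq (by ring)

/-- Both sides are continuous in `z` and agree on test functions. Uniform continuity of the
evaluation there ensures that the extension in `evalH` really extends it. -/
theorem multiDEvalCLM_eq_evalH (hC : DominatesDerivatives L N C) (x : E3) (z : HSpace L) :
    multiDEvalCLM hC 0 x z = evalH z x := by
  refine UniformSpace.Completion.induction_on z (isClosed_eq (ContinuousLinearMap.continuous _)
    UniformSpace.Completion.continuous_extension) fun f => ?_
  have hu : UniformContinuous fun f : PreH L => (show 𝓓(O, E3) from f) x :=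
    ((multiDEval L 0 x).mkContinuous C (hC 0 (by simp) x)).uniformContinuous
  rw [multiDEvalCLM_coe hC (by simp), evalH, UniformSpace.Completion.extension_coe hu]
  rfl

/-- If the norm of `H` dominates the Sobolev norm of order `n + 5`, then the evaluation is of
class `C^{n+1}`. -/
theorem nonempty_smoothEval (hO : Bornology.IsBounded (O : Set E3)) {n : ℕ} {c : ℝ} (hc : 0 < c)
    (hL : ∀ f : PreH L, c * sobolevNorm (n + 5) f ≤ ‖f‖) : Nonempty (SmoothEval L n) := by
  set C := Real.sqrt (volume.real (O : Set E3)) / c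
  have hC0 : 0 ≤ C := by positivity
  -- The Sobolev inequality costs three of the `n + 5` derivatives. Of the remaining `n + 2`, the
  -- last one serves as a Lipschitz bound, leaving class `C^{n+1}`.
  have hC : DominatesDerivatives L (n + 2) C := fun α hα x f => by
    refine (norm_multiD_le_sobolevNorm hO f (N := n + 5) (by omega) x).trans ?_
    rw [div_mul_eq_mul_div, mul_div_assoc]
    refine mul_le_mul_of_nonneg_left ?_ (Real.sqrt_nonneg _)
    rw [le_div_iff₀ hc, mul_comm]
    exact hL f
  have h0 : ∑ i : Fin 3, (0 : Fin 3 → ℕ) i = 0 := by simp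
  have hs : ContDiff ℝ (n + 1 : ℕ) fun x =>
      multiDEvalCLM hC 0 x :=
    contDiff_of_taylor (D := multiDEvalCLM hC) (N := n + 2) (c := 9 * C) (by positivity)
      (fun α hα => norm_multiDEvalCLM_sub_le hC hC0 hα)
      (fun α hα => norm_multiDEvalCLM_taylor_le hC hC0 hα) (n + 1) (by rw [h0]; omega)
  refine ⟨⟨⟨_, hs.continuous⟩, 9 * C.toNNReal, ?_, hs, multiDEvalCLM_eq_evalH hC, fun x hx => ?_⟩⟩
  · refine LipschitzWith.of_dist_le_mul fun y x => ?_
    have h := norm_multiDEvalCLM_sub_le hC hC0 (α := 0) (by rw [h0]; omega) x y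
    rw [NNReal.coe_mul, Real.coe_toNNReal C hC0, dist_eq_norm y x,
      NNReal.coe_ofNat]
    exact (dist_eq_norm _ _).trans_le h
  · have h : ‖multiDEvalCLM hC 0 x‖ ≤ 0 := opNorm_le_of_preH le_rfl fun f => ?_
    · refine ContinuousLinearMap.ext fun z => norm_le_zero_iff.1 ?_
      exact ((multiDEvalCLM hC 0 x).le_of_opNorm_le h z).trans_eq (zero_mul _)
    have hf : x ∉ tsupport (show 𝓓(O, E3) from f) := fun h =>
      hx (TestFunction.tsupport_subset (show 𝓓(O, E3) from f) h)
    have h : multiD 0 (show 𝓓(O, E3) from f) x = 0 := image_eq_zero_of_notMem_tsupport hf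
    rw [multiDEvalCLM_coe hC (by simp), h, norm_zero, zero_mul]

end Evaluation

end ImageMatching

/-! ### Weak compactness and lower semicontinuity -/

namespace ImageMatching

open Filter Topology

section WeakCompactness

universe v

variable {V : Type v} [NormedAddCommGroup V] [InnerProductSpace ℝ V]

/-- The closed ball of a Hilbert space with the weak topology, as a compact Hausdorff space. -/
theorem exists_weakly_compact_ball [CompleteSpace V] (R : ℝ) :
    ∃ (W : Type v) (_ : TopologicalSpace W) (_ : CompactSpace W) (_ : T2Space W) (θ : W → V),
      (∀ w, ‖θ w‖ ≤ R) ∧ (∀ ℓ : V →L[ℝ] ℝ, Continuous fun w => ℓ (θ w)) ∧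
        ∀ v, ‖v‖ ≤ R → ∃ w, θ w = v := by
  -- Compactness is Banach–Alaoglu in the dual, transported to `V` by the Riesz isometry;
  -- separability plays no role.
  let S : Set (WeakDual ℝ V) := WeakDual.toStrongDual ⁻¹' Metric.closedBall 0 R
  have hS : IsCompact S := WeakDual.isCompact_closedBall 0 R
  let e := InnerProductSpace.toDual ℝ V
  refine ⟨S, inferInstance, isCompact_iff_compactSpace.1 hS, inferInstance,
    fun w => e.symm (WeakDual.toStrongDual w.1), fun w => ?_, fun ℓ => ?_, fun v hv => ?_⟩
  · rw [LinearIsometryEquiv.norm_map]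
    exact mem_closedBall_zero_iff.1 w.2
  · have h (w : S) : ℓ (e.symm (WeakDual.toStrongDual w.1)) = w.1 (e.symm ℓ) := by
      have h1 : e (e.symm ℓ) = ℓ := e.apply_symm_apply ℓ
      have h2 : e (e.symm (WeakDual.toStrongDual w.1)) = WeakDual.toStrongDual w.1 :=
        e.apply_symm_apply _
      calc ℓ (e.symm (WeakDual.toStrongDual w.1))
          = inner ℝ (e.symm ℓ) (e.symm (WeakDual.toStrongDual w.1)) := by
            conv_lhs => rw [← h1]
            exact InnerProductSpace.toDual_apply_apply
        _ = inner ℝ (e.symm (WeakDual.toStrongDual w.1)) (e.symm ℓ) := real_inner_comm _ _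
        _ = e (e.symm (WeakDual.toStrongDual w.1)) (e.symm ℓ) :=
            InnerProductSpace.toDual_apply_apply.symm
        _ = w.1 (e.symm ℓ) := by rw [h2]; rfl
    simp only [h]
    exact (WeakDual.eval_continuous (e.symm ℓ)).comp continuous_subtype_val
  · refine ⟨⟨WeakDual.toStrongDual.symm (e v), ?_⟩, ?_⟩
    · simpa [S] using hv
    · simp

/-- A closed ball is an intersection of the half-spaces `⟨v, ·⟩ ≤ ‖v‖ r`, hence weakly closed. -/
theorem lowerSemicontinuous_enorm_sq {W : Type*} [TopologicalSpace W] {θ : W → V}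
    (hθ : ∀ ℓ : V →L[ℝ] ℝ, Continuous fun w => ℓ (θ w)) :
    LowerSemicontinuous fun w => ‖θ w‖ₑ ^ 2 := by
  have h : LowerSemicontinuous fun w => ‖θ w‖ := by
    refine lowerSemicontinuous_iff_isClosed_preimage.2 fun r => ?_
    by_cases hr : 0 ≤ r
    · have : (fun w => ‖θ w‖) ⁻¹' Iic r =
          ⋂ v : V, {w | innerSL ℝ v (θ w) ≤ ‖v‖ * r} := by
        ext w
        simp only [mem_preimage, mem_Iic, mem_iInter, mem_ofPred_eq, innerSL_apply_apply]
        constructor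
        · intro h v
          exact (real_inner_le_norm _ _).trans (mul_le_mul_of_nonneg_left h (norm_nonneg _))
        · intro h
          have h1 := h (θ w)
          rw [real_inner_self_eq_norm_mul_norm] at h1
          rcases (norm_nonneg (θ w)).eq_or_lt with h0 | h0
          · rwa [← h0]
          · exact le_of_mul_le_mul_left h1 h0
      rw [this]
      exact isClosed_iInter fun v => isClosed_le (hθ _) continuous_const
    · have : (fun w => ‖θ w‖) ⁻¹' Iic r = ∅ := by
        ext w
        simp only [mem_preimage, mem_Iic, mem_empty_iff_false, iff_false, not_le]
        exact (not_le.1 hr).trans_le (norm_nonneg _)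
      rw [this]
      exact isClosed_empty
  have hg : Continuous fun r : ℝ => ENNReal.ofReal r ^ 2 :=
    (ENNReal.continuous_pow 2).comp ENNReal.continuous_ofReal
  have hm : Monotone fun r : ℝ => ENNReal.ofReal r ^ 2 := fun a b hab =>
    pow_le_pow_left' (ENNReal.ofReal_le_ofReal hab) 2
  simpa only [Function.comp_def, ofReal_norm] using hg.comp_lowerSemicontinuous h hm

end WeakCompactness

/-! ### The matching functional and its level sets -/

section Functional

variable {O : Opens E3} {p : ℕ} {T : E3 → EuclideanSpace ℝ (Fin p)}
  {ι : Type*} [Fintype ι] {X : ι → Set E3}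

theorem measurable_dataFn (hX : ∀ i, MeasurableSet (X i)) (d : ι → EuclideanSpace ℝ (Fin p)) :
    Measurable (dataFn X d) :=
  Finset.measurable_fun_sum _ fun i _ => measurable_const.indicator (hX i)

theorem norm_dataFn_le (X : ι → Set E3) (d : ι → EuclideanSpace ℝ (Fin p)) (x : E3) :
    ‖dataFn X d x‖ ≤ ∑ i, ‖d i‖ :=
  norm_sum_le_of_le _ fun _ _ => norm_indicator_le_norm_self _ _

/-- Fatou's lemma for the matching functional on maps of `O` to itself. -/
theorem lowerSemicontinuous_matching (hT : ContinuousOn T (O : Set E3))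
    (hX : ∀ i, MeasurableSet (X i)) (d : ι → EuclideanSpace ℝ (Fin p)) :
    LowerSemicontinuous fun g : {g : C(E3, E3) // MapsTo g O O} =>
      ∫⁻ x in (O : Set E3), ‖T (g.1 x) - dataFn X d x‖ₑ ^ 2 := by
  -- Fatou's lemma concerns sequences, and sequences suffice in the space of continuous maps. The
  -- weak ball need not be sequential, so semicontinuity is proved here and pulled back later.
  refine lowerSemicontinuous_iff_isClosed_preimage.2 fun y => IsSeqClosed.isClosed ?_
  intro u g hu hg
  have hm (j : ℕ) : AEMeasurable (fun x => ‖T ((u j).1 x) - dataFn X d x‖ₑ ^ 2)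
      (volume.restrict (O : Set E3)) := by
    have h1 : AEStronglyMeasurable (fun x => T ((u j).1 x)) (volume.restrict (O : Set E3)) :=
      (hT.comp (u j).1.continuous.continuousOn (u j).2).aestronglyMeasurable O.2.measurableSet
    exact (h1.sub (measurable_dataFn hX d).aestronglyMeasurable).enorm.pow_const 2
  have hlim : ∀ x ∈ (O : Set E3), Tendsto (fun j => ‖T ((u j).1 x) - dataFn X d x‖ₑ ^ 2) atTop
      (𝓝 (‖T (g.1 x) - dataFn X d x‖ₑ ^ 2)) := by
    intro x hx
    have h1 : Tendsto (fun j => (u j).1 x) atTop (𝓝 (g.1 x)) :=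
      (((continuous_eval_const x).comp continuous_subtype_val).tendsto g).comp hg
    have h2 : Tendsto (fun j => T ((u j).1 x)) atTop (𝓝 (T (g.1 x))) :=
      ((hT.continuousAt (O.2.mem_nhds (g.2 hx))).tendsto).comp h1
    exact ((ENNReal.continuous_pow 2).tendsto _).comp (h2.sub_const _).enorm
  change ∫⁻ x in (O : Set E3), ‖T (g.1 x) - dataFn X d x‖ₑ ^ 2 ≤ y
  calc ∫⁻ x in (O : Set E3), ‖T (g.1 x) - dataFn X d x‖ₑ ^ 2
      = ∫⁻ x in (O : Set E3), liminf (fun j => ‖T ((u j).1 x) - dataFn X d x‖ₑ ^ 2) atTop :=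
        setLIntegral_congr_fun O.2.measurableSet fun x hx => (hlim x hx).liminf_eq.symm
    _ ≤ liminf (fun j => ∫⁻ x in (O : Set E3), ‖T ((u j).1 x) - dataFn X d x‖ₑ ^ 2) atTop :=
        lintegral_liminf_le' hm
    _ ≤ y := liminf_le_of_le (by isBoundedDefault) fun b hb => by
        obtain ⟨j, hj⟩ := hb.exists
        exact hj.trans (hu j)

variable {L : DiffOp O} {n : ℕ} (A : SmoothEval L n)

include A

theorem SmoothEval.Jfun_lt_top (hO : Bornology.IsBounded (O : Set E3))
    (hT : ∃ C : ℝ, ∀ x ∈ O, ‖T x‖ ≤ C) (X : ι → Set E3) (d : ι → EuclideanSpace ℝ (Fin p))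
    (ϑ : VSpace L) : Jfun T X d ϑ < ⊤ := by
  obtain ⟨C, hC⟩ := hT
  have h : ∫⁻ x in (O : Set E3), ‖T (flowMap ϑ x) - dataFn X d x‖ₑ ^ 2 ≤
      ∫⁻ _ in (O : Set E3), ENNReal.ofReal (C + ∑ i, ‖d i‖) ^ 2 := by
    refine setLIntegral_mono measurable_const fun x hx => pow_le_pow_left' ?_ 2
    rw [← ofReal_norm]
    exact ENNReal.ofReal_le_ofReal ((norm_sub_le _ _).trans
      (add_le_add (hC _ (A.flowMap_mem ϑ hx)) (norm_dataFn_le X d x)))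
  have h' : ∫⁻ x in (O : Set E3), ‖T (flowMap ϑ x) - dataFn X d x‖ₑ ^ 2 < ⊤ := by
    refine h.trans_lt ?_
    rw [setLIntegral_const]
    exact ENNReal.mul_lt_top (ENNReal.pow_lt_top ENNReal.ofReal_lt_top) hO.measure_lt_top
  exact ENNReal.mul_lt_top (by norm_num)
    (ENNReal.add_lt_top.2 ⟨ENNReal.pow_lt_top enorm_lt_top, h'⟩)

theorem SmoothEval.lowerSemicontinuous_Jfun (hT : ContinuousOn T (O : Set E3))
    (hX : ∀ i, MeasurableSet (X i)) (d : ι → EuclideanSpace ℝ (Fin p))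
    {W : Type*} [TopologicalSpace W] [CompactSpace W] [T2Space W] {θ : W → VSpace L} {R : ℝ}
    (hR : ∀ w, ‖θ w‖ ≤ R) (hθ : ∀ ℓ : VSpace L →L[ℝ] ℝ, Continuous fun w => ℓ (θ w)) :
    LowerSemicontinuous fun w => Jfun T X d (θ w) := by
  obtain ⟨G, hG, hGe⟩ := A.exists_flowFamily hR hθ
  let Φ : C(W, C(E3, E3)) := ContinuousMap.curry
    ((ContinuousMap.uncurry ⟨G, hG.continuous⟩).comp ⟨Prod.swap, continuous_swap⟩)
  have hΦ (w : W) (x : E3) : Φ w x = flowMap (θ w) x := (hGe w x).symm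
  have hmap (w : W) : MapsTo (Φ w) O O := fun x hx => by
    rw [hΦ]
    exact A.flowMap_mem _ hx
  have h1 := (lowerSemicontinuous_matching hT hX d).comp
    (Φ.continuous.subtype_mk hmap)
  simp only [hΦ, Function.comp_def] at h1
  exact (ENNReal.continuous_const_mul (by norm_num)).comp_lowerSemicontinuous
    ((lowerSemicontinuous_enorm_sq hθ).add h1) (fun _ _ hab => mul_le_mul' le_rfl hab)

/-- The bound on `J` confines the controls to a ball; there the sublevel set is weakly closed, hence
weakly compact, and the flow map is weakly continuous. -/
theorem SmoothEval.isCompact_image_flowDiffeo (hT : ContinuousOn T (O : Set E3))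
    (hX : ∀ i, MeasurableSet (X i)) (d : ι → EuclideanSpace ℝ (Fin p)) {c : ℝ≥0∞} (hc : c ≠ ⊤) :
    IsCompact (A.flowDiffeo '' {ϑ : VSpace L | Jfun T X d ϑ ≤ c}) := by
  obtain ⟨W, _, _, _, θ, hR, hθ, hsurj⟩ :=
    -- From `‖ϑ‖² ≤ 2c` follows `‖ϑ‖ ≤ 2c + 1`, which avoids square roots.
    exists_weakly_compact_ball (V := VSpace L) (2 * c.toReal + 1)
  have hcl : IsClosed {w | Jfun T X d (θ w) ≤ c} :=
    lowerSemicontinuous_iff_isClosed_preimage.1 (A.lowerSemicontinuous_Jfun hT hX d hR hθ) c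
  have h := hcl.isCompact.image (A.continuous_flowDiffeo hR hθ)
  convert h using 1
  ext g
  constructor
  · rintro ⟨ϑ, hϑ, rfl⟩
    have h1 : ‖ϑ‖ₑ ^ 2 ≤ 2 * c := by
      have h2 : (1 / 2 : ℝ≥0∞) * ‖ϑ‖ₑ ^ 2 ≤ c :=
        (mul_le_mul_right le_self_add _).trans hϑ
      calc ‖ϑ‖ₑ ^ 2 = 2 * ((1 / 2) * ‖ϑ‖ₑ ^ 2) := by
            rw [← mul_assoc, one_div, ENNReal.mul_inv_cancel (by norm_num) (by norm_num), one_mul]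
        _ ≤ 2 * c := by gcongr
    have h2 := (ENNReal.toReal_le_toReal (by finiteness) (by finiteness)).2 h1
    rw [ENNReal.toReal_pow, toReal_enorm, ENNReal.toReal_mul, ENNReal.toReal_ofNat] at h2
    obtain ⟨w, rfl⟩ := hsurj ϑ (by nlinarith [norm_nonneg ϑ])
    exact ⟨w, hϑ, rfl⟩
  · rintro ⟨w, hw, rfl⟩
    exact ⟨θ w, hw, rfl⟩

theorem SmoothEval.Jhat_flowDiffeo_le (T : E3 → EuclideanSpace ℝ (Fin p)) (X : ι → Set E3)
    (d : ι → EuclideanSpace ℝ (Fin p)) (ϑ : VSpace L) :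
    Jhat L T X d (A.flowDiffeo ϑ) ≤ Jfun T X d ϑ :=
  iInf₂_le (f := fun (ϑ' : VSpace L) (_ : (A.flowDiffeo ϑ : E3 → E3) = flowMap ϑ') =>
    Jfun T X d ϑ') ϑ rfl

/-- An infimum at most `M` is approached by controls with `J ≤ c` for every `c > M`, so no minimiser
is required. Only finite `c` are used, since the images are known to be compact only for those. -/
theorem SmoothEval.setOf_Jhat_le (T : E3 → EuclideanSpace ℝ (Fin p)) (X : ι → Set E3)
    (d : ι → EuclideanSpace ℝ (Fin p)) (M : ℝ≥0∞) :
    {h : DiffeoGroup n | Jhat L T X d h ≤ M} =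
      ⋂ c : Ioo M ⊤, A.flowDiffeo '' {ϑ : VSpace L | Jfun T X d ϑ ≤ c} := by
  ext h
  simp only [mem_ofPred_eq, mem_iInter]
  constructor
  · intro hM c
    have hlt : Jhat L T X d h < c := hM.trans_lt c.2.1
    simp only [Jhat, iInf_lt_iff] at hlt
    obtain ⟨ϑ, hh, hJ⟩ := hlt
    exact ⟨ϑ, hJ.le, DiffeoGroup.ext hh.symm⟩
  · intro H
    refine le_of_forall_gt_imp_ge_of_dense fun c hc => ?_
    rcases eq_or_ne c ⊤ with rfl | hc'
    · exact le_top
    obtain ⟨ϑ, hJ, rfl⟩ := H ⟨c, hc, hc'.lt_top⟩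
    exact (A.Jhat_flowDiffeo_le T X d ϑ).trans hJ

/-- Every control produces an element of `G^n`, so restricting the outer infimum to diffeomorphisms
loses nothing. -/
theorem SmoothEval.lam_eq (T : E3 → EuclideanSpace ℝ (Fin p)) (X : ι → Set E3)
    (d : ι → EuclideanSpace ℝ (Fin p)) : lam L n T X d = ⨅ ϑ : VSpace L, Jfun T X d ϑ := by
  refine le_antisymm (le_iInf fun ϑ => ?_) (le_iInf fun h => le_iInf₂ fun ϑ _ => iInf_le _ ϑ)
  exact (iInf_le _ (A.flowDiffeo ϑ)).trans (A.Jhat_flowDiffeo_le T X d ϑ)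

end Functional

end ImageMatching

theorem proposition5p3
    (O : Opens E3) (hO : Bornology.IsBounded (O : Set E3))
    (m k : ℕ) (hm : 3 ≤ m) (hk : m = k + 2)
    (L : DiffOp O)
    (hL : ∃ c : ℝ, 0 < c ∧ ∀ f : PreH L, c * sobolevNorm (m + 2) f ≤ ‖f‖)
    (p : ℕ) (T : E3 → EuclideanSpace ℝ (Fin p))
    (hTcont : ContinuousOn T (O : Set E3))
    (hTbdd : ∃ C : ℝ, ∀ x ∈ O, ‖T x‖ ≤ C)
    (ι : Type*) [Fintype ι] (X : ι → Set E3)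
    (hXmeas : ∀ i, MeasurableSet (X i))
    (hXdisj : Pairwise (fun i j => Disjoint (X i) (X j)))
    (hXunion : ⋃ i, X i = (O : Set E3))
    (d : ι → EuclideanSpace ℝ (Fin p)) :
    lam L (k - 1) T X d < ⊤ ∧
    lam L (k - 1) T X d = ⨅ ϑ : VSpace L, Jfun T X d ϑ ∧
    IsRateFunction (Ifun L (k - 1) T X d) := by
  obtain ⟨c, hc, hL⟩ := hL
  -- Since `m ≥ 3` forces `k ≥ 1`, the natural number subtraction is not truncated.
  have hmk : m + 2 = (k - 1) + 5 := by omega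
  rw [hmk] at hL
  obtain ⟨A⟩ := nonempty_smoothEval hO hc hL
  have hlam := A.lam_eq T X d
  have hlt : lam L (k - 1) T X d < ⊤ := by
    rw [hlam]
    exact (iInf_le _ 0).trans_lt (A.Jfun_lt_top hO hTbdd X d 0)
  refine ⟨hlt, hlam, fun M hM => ?_⟩
  have hM' : M + lam L (k - 1) T X d < ⊤ := ENNReal.add_lt_top.2 ⟨hM.lt_top, hlt⟩
  -- Finiteness of `λ_d` enters here: at least one finite level lies above `M + λ_d`, so the
  -- intersection is a closed subset of a compact image.
  have : Nonempty (Ioo (M + lam L (k - 1) T X d) ⊤) := (nonempty_Ioo.2 hM').to_subtype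
  simp only [Ifun, tsub_le_iff_right]
  rw [A.setOf_Jhat_le T X d]
  have hK (c : Ioo (M + lam L (k - 1) T X d) ⊤) :=
    A.isCompact_image_flowDiffeo hTcont hXmeas d c.2.2.ne
  exact (hK (Classical.arbitrary _)).of_isClosed_subset
    (isClosed_iInter fun c => (hK c).isClosed) (iInter_subset _ _)
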